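/- **Proposition 2.1 (decreasing energy).** Let $N\ge 1$, $p>1$, $\beta:=\frac1{p-1}$, $T>0$, and let $u$ be a strong solution on $[0,T)\times\mathbb R^N$ of $$u_{tt}-\Delta u=u_t|u_t|^{p-1},\qquad (u,u_t)|_{t=0}=(u_0,u_1),$$ that is, $u\in C([0,T);H^2_{loc})\cap C^1([0,T);H^1_{loc})\cap C^2([0,T);L^2_{loc})$ and the equation holds a.e. in $\mathbb R^N$ for every $t\in[0,T)$. Let $a\in\mathbb R^N$, $T'>0$, $s_0:=-\log T'$, and let $J:=\{s\ge s_0:\ T'-e^{-s}<T\}$ (so $J=[s_0,\infty)$ if $T'\le T$, and $J=[s_0,-\log(T'-T))$ if $T'>T$). For $s\in J$ and $z\in\mathbb R^N$ put $$\theta(s,z):=(T'-t)^{\beta}\,u_t(t,a+z)\ \text{ with } t=T'-e^{-s},\qquad \theta_{00}(z):=(T')^{\beta+1}u_0(a+z).$$ Let $g(s):=e^{(\beta+1)s}$, $g_2(s):=e^{(\beta-1)s}$, $B:=\{|z|\le1\}$, $\rho(z):=1-|z|^2$, let $\alpha>\max\{\beta(\beta+1)/2,\,1+2\beta,\,2\}$,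 and define for $s\in J$, writing $\theta(s)$ for $\theta(s,\cdot)$, $$\begin{aligned} E(s):={}&\frac\beta2\int_Bg(s)\rho^\alpha\theta(s)^2dz-\frac1{p+1}\int_Bg(s)\rho^\alpha|\theta(s)|^{p+1}dz\\ &-\frac18\int_{s_0}^{s}\int_B\rho^\alpha g_2(\tau)\left[|4\nabla\theta(\tau)-\nabla\theta(s)|^2-|\nabla\theta(s)|^2\right]dz\,d\tau\\ &-\alpha\int_{s_0}^s\int_Bg_2(\tau)\left[N\rho-2(\alpha-1)|z|^2\right]\rho^{\alpha-2}\left[|\theta(s)-\theta(\tau)|^2-|\theta(s)|^2\right]dz\,d\tau\\ &-\alpha\int_{s_0}^s\int_Bg(\tau)\rho^{\alpha-1}\left[|e^{-2\tau}z\cdot\nabla\theta(s)-\theta(\tau)|^2-|e^{-2\tau}z\cdot\nabla\theta(s)|^2\right]dz\,d\tau\\ &+\frac12g(s_0)\int_B\rho^\alpha\left[|\nabla\theta(s)+\nabla\theta_{00}|^2-|\nabla\theta(s)|^2\right]dz\\ &+\alpha g(s_0)\int_B\rho^{\alpha-1}\left[|\theta(s)-z\cdot\nabla\theta_{00}|^2-|\theta(s)|^2\right]dz.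 \end{aligned}$$ Then the weak gradients $\nabla\theta(s)$, $\nabla\theta_{00}$ and the $L^2_{loc}$-valued derivative $\theta_s$ exist, all the integrals above and below converge, the energy $s\mapsto E(s)$ is nonincreasing on $J$, and for all $s\ge s_0$ with $s+1\in J$ $$\begin{aligned} E(s+1)-E(s)={}&-\frac{\beta+1}{p+1}\int_s^{s+1}\int_Bg(s')\rho^\alpha|\theta(s')|^{p+1}dz\,ds'-\int_s^{s+1}\int_Bg(s')\rho^\alpha\theta_s(s')^2dz\,ds'\\ &-\left[\alpha-\frac{\beta(\beta+1)}2\right]\int_s^{s+1}\int_Bg(s')\rho^\alpha\theta(s')^2dz\,ds'\\ &-\alpha\int_s^{s+1}\int_Bg(s')\rho^{\alpha-1}|z|^2|\theta(s')|^2dz\,ds'\\ &-\int_s^{s+1}\int_Bg_2(s')\rho^\alpha|\nabla\theta(s')|^2dz\,ds'. \end{aligned}$$ -/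

import Mathlib

open MeasureTheory Set Filter Topology
open scoped ContDiff ENNReal

namespace WaveEnergy

noncomputable section

/-- The physical space `ℝ^N` with its Euclidean norm. -/
abbrev X (N : ℕ) : Type := EuclideanSpace ℝ (Fin N)

/-! ### Weak derivatives and local Sobolev regularity -/

/-- `f ∈ L²_loc(ℝ^N)`. -/
def MemL2Loc {N : ℕ} (f : X N → ℝ) : Prop :=
  ∀ R : ℝ, MemLp f 2 (volume.restrict (Metric.closedBall 0 R))

/-- `g` is a weak `i`-th partial derivative of `f` on `ℝ^N`, tested against `C_c^∞`. -/
def HasWeakPartial {N : ℕ} (i : Fin N) (f g : X N → ℝ) : Prop :=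
  LocallyIntegrable f volume ∧ LocallyIntegrable g volume ∧
    ∀ φ : X N → ℝ, ContDiff ℝ ∞ φ → HasCompactSupport φ →
      ∫ x, f x * fderiv ℝ φ x (EuclideanSpace.single i 1) = -∫ x, g x * φ x

open Classical in
/-- A representative of the weak partial derivative `∂_i f` (unique up to null sets);
`0` if there is none. -/
def weakPartial {N : ℕ} (i : Fin N) (f : X N → ℝ) : X N → ℝ :=
  if h : ∃ g, HasWeakPartial i f g then h.choose else 0

/-- The weak gradient `∇f`. -/
def weakGrad {N : ℕ} (f : X N → ℝ) (x : X N) : X N :=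
  WithLp.toLp 2 fun i => weakPartial i f x

/-- The weak Laplacian `Δf = ∑ ∂_i ∂_i f`. -/
def weakLaplacian {N : ℕ} (f : X N → ℝ) (x : X N) : ℝ :=
  ∑ i, weakPartial i (weakPartial i f) x

/-- `f ∈ C(I; H^k_loc(ℝ^N))`. -/
def ContinuousIntoHLoc {N : ℕ} : ℕ → Set ℝ → (ℝ → X N → ℝ) → Prop
  | 0, I, f =>
      ∀ t ∈ I, MemL2Loc (f t) ∧
        ∀ R : ℝ, Tendsto
          (fun t' => eLpNorm (f t' - f t) 2 (volume.restrict (Metric.closedBall 0 R)))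
          (𝓝[I] t) (𝓝 0)
  | k + 1, I, f =>
      ContinuousIntoHLoc 0 I f ∧
        ∀ i : Fin N, (∀ t ∈ I, ∃ g, HasWeakPartial i (f t) g) ∧
          ContinuousIntoHLoc k I fun t => weakPartial i (f t)

/-- `w` is the derivative at `t` of `f : I → L²_loc(ℝ^N)`
(one-sided when `t` is an end point of the interval `I`). -/
def HasTimeDeriv {N : ℕ} (I : Set ℝ) (f : ℝ → X N → ℝ) (w : X N → ℝ) (t : ℝ) : Prop :=
  MemL2Loc w ∧
    ∀ R : ℝ, Tendsto
      (fun t' => eLpNorm (fun x => (t' - t)⁻¹ * (f t' x - f t x) - w x) 2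
        (volume.restrict (Metric.closedBall 0 R)))
      (𝓝[I \ {t}] t) (𝓝 0)

open Classical in
/-- A representative of the `L²_loc`-valued time derivative of `f` on `I` (unique up to null
sets); `0` if there is none. -/
def timeDeriv {N : ℕ} (I : Set ℝ) (f : ℝ → X N → ℝ) (t : ℝ) : X N → ℝ :=
  if h : ∃ w, HasTimeDeriv I f w t then h.choose else 0

/-! ### The wave equation `u_tt - Δu = u_t |u_t|^(p-1)` -/

/-- `u` is a strong solution on `[0, T) × ℝ^N` of `u_tt - Δu = u_t |u_t|^(p-1)` with initial
data `(u₀, u₁)`: it lies in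
`C([0,T); H²_loc) ∩ C¹([0,T); H¹_loc) ∩ C²([0,T); L²_loc)`
and the equation holds almost everywhere in space at every time. -/
structure IsStrongSolution {N : ℕ} (p T : ℝ) (u₀ u₁ : X N → ℝ) (u : ℝ → X N → ℝ) : Prop where
  cont_H2 : ContinuousIntoHLoc 2 (Ico 0 T) u
  hasDeriv : ∀ t ∈ Ico 0 T, ∃ w, HasTimeDeriv (Ico 0 T) u w t
  deriv_cont_H1 : ContinuousIntoHLoc 1 (Ico 0 T) (timeDeriv (Ico 0 T) u)
  hasDeriv_two : ∀ t ∈ Ico 0 T, ∃ w, HasTimeDeriv (Ico 0 T) (timeDeriv (Ico 0 T) u) w t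
  deriv_two_cont :
    ContinuousIntoHLoc 0 (Ico 0 T) (timeDeriv (Ico 0 T) (timeDeriv (Ico 0 T) u))
  equation : ∀ t ∈ Ico 0 T, ∀ᵐ x,
    timeDeriv (Ico 0 T) (timeDeriv (Ico 0 T) u) t x - weakLaplacian (u t) x
      = timeDeriv (Ico 0 T) u t x * |timeDeriv (Ico 0 T) u t x| ^ (p - 1)
  initial_value : u 0 =ᵐ[volume] u₀
  initial_velocity : timeDeriv (Ico 0 T) u 0 =ᵐ[volume] u₁

/-! ### Similarity variables -/

/-- `β = 1 / (p - 1)`. -/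
def bet (p : ℝ) : ℝ := 1 / (p - 1)

/-- `g(s) = e^{(β+1)s}`. -/
def g (p s : ℝ) : ℝ := Real.exp ((bet p + 1) * s)

/-- `g₂(s) = e^{(β-1)s}`. -/
def g₂ (p s : ℝ) : ℝ := Real.exp ((bet p - 1) * s)

/-- `s₀ = -log T'`. -/
def sZero (T' : ℝ) : ℝ := -Real.log T'

/-- The times `s ≥ s₀` at which `θ` is defined: those for which `t = T' - e^{-s}` is `< T`.
This is all of `[s₀, ∞)` if `T' ≤ T`, and `[s₀, -log(T' - T))` if `T' > T`. -/
def sDomain (T T' : ℝ) : Set ℝ := {s | sZero T' ≤ s ∧ T' - Real.exp (-s) < T}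

/-- `θ(s, z) = (T' - t)^β u_t(t, a + z)`, where `t = T' - e^{-s}`. -/
def theta {N : ℕ} (p T T' : ℝ) (a : X N) (u : ℝ → X N → ℝ) (s : ℝ) (z : X N) : ℝ :=
  Real.exp (-s) ^ bet p * timeDeriv (Ico 0 T) u (T' - Real.exp (-s)) (a + z)

/-- `θ₀₀(z) = T'^(β+1) u₀(a + z)`. -/
def thetaInit {N : ℕ} (p T' : ℝ) (a : X N) (u₀ : X N → ℝ) (z : X N) : ℝ :=
  T' ^ (bet p + 1) * u₀ (a + z)

/-! ### The weighted energy -/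

/-- The unit ball `B = {|z| ≤ 1}`. -/
def B (N : ℕ) : Set (X N) := Metric.closedBall 0 1

/-- The weight `ρ(z) = 1 - |z|²`. -/
def rho {N : ℕ} (z : X N) : ℝ := 1 - ‖z‖ ^ 2

/-- `z · ∇f(z)`. -/
def radial {N : ℕ} (f : X N → ℝ) (z : X N) : ℝ := inner ℝ z (weakGrad f z)

section Integrands

variable {N : ℕ} (p α s₀ : ℝ) (θ : ℝ → X N → ℝ) (θ₀₀ : X N → ℝ)

def e₁ (s : ℝ) (z : X N) : ℝ := g p s * rho z ^ α * θ s z ^ 2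

def e₂ (s : ℝ) (z : X N) : ℝ := g p s * rho z ^ α * |θ s z| ^ (p + 1)

def e₃ (s τ : ℝ) (z : X N) : ℝ :=
  rho z ^ α * g₂ p τ *
    (‖(4 : ℝ) • weakGrad (θ τ) z - weakGrad (θ s) z‖ ^ 2 - ‖weakGrad (θ s) z‖ ^ 2)

def e₄ (s τ : ℝ) (z : X N) : ℝ :=
  g₂ p τ * (N * rho z - 2 * (α - 1) * ‖z‖ ^ 2) * rho z ^ (α - 2) *
    (|θ s z - θ τ z| ^ 2 - |θ s z| ^ 2)

def e₅ (s τ : ℝ) (z : X N) : ℝ :=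
  g p τ * rho z ^ (α - 1) *
    (|Real.exp (-2 * τ) * radial (θ s) z - θ τ z| ^ 2
      - |Real.exp (-2 * τ) * radial (θ s) z| ^ 2)

def e₆ (s : ℝ) (z : X N) : ℝ :=
  rho z ^ α * (‖weakGrad (θ s) z + weakGrad θ₀₀ z‖ ^ 2 - ‖weakGrad (θ s) z‖ ^ 2)

def e₇ (s : ℝ) (z : X N) : ℝ :=
  rho z ^ (α - 1) * (|θ s z - radial θ₀₀ z| ^ 2 - |θ s z| ^ 2)

/-- The energy `E(s)`. -/
def energy (s : ℝ) : ℝ :=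
  bet p / 2 * (∫ z in B N, e₁ p α θ s z)
    - 1 / (p + 1) * (∫ z in B N, e₂ p α θ s z)
    - 1 / 8 * (∫ τ in s₀..s, ∫ z in B N, e₃ p α θ s τ z)
    - α * (∫ τ in s₀..s, ∫ z in B N, e₄ p α θ s τ z)
    - α * (∫ τ in s₀..s, ∫ z in B N, e₅ p α θ s τ z)
    + 1 / 2 * g p s₀ * (∫ z in B N, e₆ α θ θ₀₀ s z)
    + α * g p s₀ * (∫ z in B N, e₇ α θ θ₀₀ s z)

/-- The (iterated) integral of `f` over `[a, b] × B` converges. -/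
def IteratedIntegrable (f : ℝ → X N → ℝ) (a b : ℝ) : Prop :=
  (∀ τ ∈ Icc a b, IntegrableOn (f τ) (B N)) ∧
    IntervalIntegrable (fun τ => ∫ z in B N, f τ z) volume a b

/-- All the integrals in the definition of `E(s)` converge. -/
def EnergyConverges (s : ℝ) : Prop :=
  IntegrableOn (e₁ p α θ s) (B N) ∧ IntegrableOn (e₂ p α θ s) (B N) ∧
  IteratedIntegrable (e₃ p α θ s) s₀ s ∧ IteratedIntegrable (e₄ p α θ s) s₀ s ∧
  IteratedIntegrable (e₅ p α θ s) s₀ s ∧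
  IntegrableOn (e₆ α θ θ₀₀ s) (B N) ∧ IntegrableOn (e₇ α θ θ₀₀ s) (B N)

/-! The integrands of the dissipation; in `d₂` the argument `θs` stands for `∂_s θ`. -/

def d₁ (s : ℝ) (z : X N) : ℝ := g p s * rho z ^ α * |θ s z| ^ (p + 1)

def d₂ (θs : ℝ → X N → ℝ) (s : ℝ) (z : X N) : ℝ := g p s * rho z ^ α * θs s z ^ 2

def d₃ (s : ℝ) (z : X N) : ℝ := g p s * rho z ^ α * θ s z ^ 2

def d₄ (s : ℝ) (z : X N) : ℝ := g p s * rho z ^ (α - 1) * ‖z‖ ^ 2 * |θ s z| ^ 2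

def d₅ (s : ℝ) (z : X N) : ℝ := g₂ p s * rho z ^ α * ‖weakGrad (θ s) z‖ ^ 2

end Integrands

end

end WaveEnergy

open WaveEnergy

/-! The squares in the energy are differences of squares, so each of them expands into a term
depending on one time only and a term bilinear in two times. The unknown has the time primitive
`w(s,z) = u(T' - e^{-s}, a+z)`, with `∂_s w = g₂ θ` and `w(s₀) = g(s₀) θ₀₀`, so each bilinear time
integral evaluates to `w(s) - w(s₀)`, or its gradient, paired with `θ(s)`. The contributions of
`w(s₀)` cancel those of `θ₀₀`, and integration by parts collects the rest. What remains
(`energy_eq`) is a local quantity, `core`, β/2 g∫ρ^α θ² - 1/(p+1) g∫ρ^α|θ|^{p+1} + ∫ρ^α ∇w·∇θ -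
2α∫ρ^{α-1}(z·∇w)θ, minus explicit time integrals of quadratic forms in `θ`, plus a constant.

In similarity variables the equation reads `g θ|θ|^{p-1} = g(θ_s + βθ) - Δw`. The last two terms of
`core` formally equal `-∫ρ^α Δw θ`; when `core` is differentiated, the terms containing `θ_s`
combine through the equation into `-g∫ρ^α θ_s²`. The derivative of the time integrals then turns
`+g₂∫ρ^α|∇θ|²` into its negative, removes the divergence form and adds `-αg∫ρ^{α-1}θ²`. Splitting
`ρ^{α-1} = ρ^α + ρ^{α-1}|z|²` gives the dissipation identity, and monotonicity is the sign of its
coefficients.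

The difficulty is regularity: `θ` is only C⁰ in time with values in H¹ and C¹ with values in L², and
`p` has no upper bound. Three devices deal with this. Freezing `∇w` at the base point and
integrating by parts replaces `∇θ` by `θ` before differentiating (`hasDerivWithinAt_energy_core`).
Convexity of `|x|^{p+1}` differentiates the potential term (`hasDerivWithinAt_of_subgradient`), the
equation itself supplying the L² continuity of the nonlinearity. A weakly differentiable curve with
continuous derivative is strongly differentiable (`hasDerivWithinAt_of_inner`); this yields both the
time derivative of `∇w` and the L² differentiability of translations, from which integration by
parts for products of H¹ functions follows. -/

namespace WaveEnergy

/-! ### Strong differentiability of curves in a Hilbert space from weak differentiability -/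

section HilbertCalculus

variable {H : Type*} [NormedAddCommGroup H] [InnerProductSpace ℝ H] [CompleteSpace H]

/-- A curve which is differentiable when tested against a separating set, with a continuous
derivative, is differentiable in norm. -/
theorem hasDerivWithinAt_of_inner {D : Set H} (hD : ∀ x : H, (∀ d ∈ D, inner ℝ x d = 0) → x = 0)
    {a b : ℝ} (hab : a < b) {f f' : ℝ → H} (hf' : ContinuousOn f' (Icc a b))
    (hw : ∀ d ∈ D, ∀ s ∈ Icc a b,
      HasDerivWithinAt (fun s => inner ℝ (f s) d) (inner ℝ (f' s) d) (Icc a b) s) :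
    ∀ s ∈ Icc a b, HasDerivWithinAt f (f' s) (Icc a b) s := by
  -- Extending the derivative by its end values makes it continuous on the whole line, so its
  -- primitive `G` is differentiable everywhere. Tested against `D`, `f - G` has derivative zero and
  -- vanishes at `a`.
  set k : ℝ → H := IccExtend hab.le ((Icc a b).domRestrict f') with hk
  have hkc : Continuous k := (continuousOn_iff_continuous_domRestrict.mp hf').Icc_extend'
  have hkeq : ∀ s ∈ Icc a b, k s = f' s := fun s hs => by
    rw [hk, IccExtend_of_mem _ _ hs]; rfl
  set G : ℝ → H := fun s => f a + ∫ τ in a..s, k τ with hG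
  have hGd : ∀ s, HasDerivAt G (k s) s := fun s =>
    (intervalIntegral.integral_hasDerivAt_right (hkc.intervalIntegrable _ _)
      (hkc.stronglyMeasurableAtFilter _ _) hkc.continuousAt).const_add _
  have hfG : ∀ s ∈ Icc a b, f s = G s := by
    intro s hs
    rw [← sub_eq_zero]
    refine hD _ fun d hd => ?_
    have hder : ∀ τ ∈ Icc a b, HasDerivWithinAt (fun τ => inner ℝ (f τ - G τ) d) 0 (Icc a b) τ := by
      intro τ hτ
      have h1 := hw d hd τ hτ
      have h2 := ((hGd τ).hasDerivWithinAt (s := Icc a b)).inner ℝ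
        (hasDerivWithinAt_const τ (Icc a b) d)
      have h3 := h1.sub h2
      rw [hkeq τ hτ] at h3
      simpa [inner_sub_left, Pi.sub_def] using h3
    have hc := constant_of_has_deriv_right_zero
      (fun τ hτ => (hder τ hτ).continuousWithinAt)
      (fun τ hτ => (hder τ (Ico_subset_Icc_self hτ)).mono_of_mem_nhdsWithin
        (Icc_mem_nhdsGE_of_mem hτ)) s hs
    rw [hc]
    simp [hG]
  intro s hs
  have := ((hGd s).hasDerivWithinAt (s := Icc a b)).congr hfG (hfG s hs)
  rwa [hkeq s hs] at this

end HilbertCalculus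

end WaveEnergy

namespace WaveEnergy

/-! ### Classes in L² and bounded multiplication operators -/

section LpTools

variable {N : ℕ} {ν : Measure (X N)}

open Classical in
/-- The class of `f` in `L²(ν)`, or `0` if `f` is not square integrable. -/
noncomputable def cls (ν : Measure (X N)) (f : X N → ℝ) : Lp ℝ 2 ν :=
  if h : MemLp f 2 ν then h.toLp f else 0

theorem cls_eq {f : X N → ℝ} (h : MemLp f 2 ν) : cls ν f = h.toLp f := by simp [cls, h]

theorem coeFn_cls {f : X N → ℝ} (h : MemLp f 2 ν) : cls ν f =ᵐ[ν] f := by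
  rw [cls_eq h]; exact h.coeFn_toLp

theorem cls_coeFn (f : Lp ℝ 2 ν) : cls ν f = f := by
  rw [cls_eq (Lp.memLp f), Lp.toLp_coeFn]

theorem cls_congr {f h : X N → ℝ} (e : f =ᵐ[ν] h) : cls ν f = cls ν h := by
  by_cases hf : MemLp f 2 ν
  · have hh : MemLp h 2 ν := (memLp_congr_ae e).1 hf
    rw [cls_eq hf, cls_eq hh]
    exact (MemLp.toLp_eq_toLp_iff hf hh).2 e
  · have hh : ¬ MemLp h 2 ν := fun hh => hf ((memLp_congr_ae e).2 hh)
    simp [cls, hf, hh]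

theorem cls_eq_iff {f h : X N → ℝ} (hf : MemLp f 2 ν) (hh : MemLp h 2 ν) :
    cls ν f = cls ν h ↔ f =ᵐ[ν] h := by
  rw [cls_eq hf, cls_eq hh, MemLp.toLp_eq_toLp_iff]

theorem cls_smul (c : ℝ) {f : X N → ℝ} (hf : MemLp f 2 ν) :
    cls ν (fun z => c * f z) = c • cls ν f := by
  have h2 : MemLp (fun z => c * f z) 2 ν := hf.const_mul c
  rw [cls_eq hf, cls_eq h2, ← MemLp.toLp_const_smul]
  rfl

theorem cls_add {f h : X N → ℝ} (hf : MemLp f 2 ν) (hh : MemLp h 2 ν) :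
    cls ν (fun z => f z + h z) = cls ν f + cls ν h := by
  rw [cls_eq hf, cls_eq hh, ← MemLp.toLp_add hf hh]
  exact cls_eq (hf.add hh)

theorem cls_sub {f h : X N → ℝ} (hf : MemLp f 2 ν) (hh : MemLp h 2 ν) :
    cls ν (fun z => f z - h z) = cls ν f - cls ν h := by
  rw [cls_eq hf, cls_eq hh, ← MemLp.toLp_sub hf hh]
  exact cls_eq (hf.sub hh)

theorem cls_sum {ι : Type*} (S : Finset ι) {f : ι → X N → ℝ} (hf : ∀ i ∈ S, MemLp (f i) 2 ν) :
    cls ν (fun z => ∑ i ∈ S, f i z) = ∑ i ∈ S, cls ν (f i) := by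
  classical
  induction S using Finset.induction_on with
  | empty =>
    simp only [Finset.sum_empty]
    rw [cls_eq (MemLp.zero' (p := 2) (μ := ν))]
    exact MemLp.toLp_zero _
  | insert a S ha ih =>
    have h1 := hf a (Finset.mem_insert_self _ _)
    have h2 : ∀ i ∈ S, MemLp (f i) 2 ν := fun i hi => hf i (Finset.mem_insert_of_mem hi)
    simp only [Finset.sum_insert ha]
    rw [cls_add h1 (memLp_finsetSum S h2), ih h2]

theorem integrable_mul_mul {φ f h : X N → ℝ} (hφ : MemLp φ ∞ ν) (hf : MemLp f 2 ν)
    (hh : MemLp h 2 ν) : Integrable (fun z => φ z * f z * h z) ν := by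
  have h1 : MemLp (fun z => φ z * f z) 2 ν := hf.mul hφ
  exact h1.integrable_mul hh

open Classical in
/-- Multiplication by an essentially bounded function, as an operator on `L²(ν)`. -/
noncomputable def mulC (ν : Measure (X N)) (φ : X N → ℝ) : Lp ℝ 2 ν →L[ℝ] Lp ℝ 2 ν :=
  if h : MemLp φ ∞ ν then (ContinuousLinearMap.mul ℝ ℝ).holderL ν ∞ 2 2 (h.toLp φ) else 0

theorem coeFn_mulC {φ : X N → ℝ} (hφ : MemLp φ ∞ ν) (f : Lp ℝ 2 ν) :
    mulC ν φ f =ᵐ[ν] fun z => φ z * f z := by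
  simp only [mulC, hφ, dif_pos, ContinuousLinearMap.holderL_apply_apply]
  filter_upwards [(ContinuousLinearMap.mul ℝ ℝ).coeFn_holder (r := 2) (hφ.toLp φ) f,
    hφ.coeFn_toLp] with z h1 h2
  rw [h1, h2]; rfl

theorem inner_cls {f h : X N → ℝ} (hf : MemLp f 2 ν) (hh : MemLp h 2 ν) :
    inner ℝ (cls ν f) (cls ν h) = ∫ z, f z * h z ∂ν := by
  rw [L2.inner_def]
  refine integral_congr_ae ?_
  filter_upwards [coeFn_cls hf, coeFn_cls hh] with z h1 h2
  rw [h1, h2]; simp [mul_comm]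

theorem inner_mulC {φ f h : X N → ℝ} (hφ : MemLp φ ∞ ν) (hf : MemLp f 2 ν) (hh : MemLp h 2 ν) :
    inner ℝ (mulC ν φ (cls ν f)) (cls ν h) = ∫ z, φ z * f z * h z ∂ν := by
  rw [L2.inner_def]
  refine integral_congr_ae ?_
  filter_upwards [coeFn_cls hf, coeFn_cls hh, coeFn_mulC hφ (cls ν f)] with z h1 h2 h3
  rw [h2, h3, h1]; simp [mul_comm]

theorem inner_mulC_comm {φ : X N → ℝ} (hφ : MemLp φ ∞ ν) (f h : Lp ℝ 2 ν) :
    inner ℝ (mulC ν φ f) h = inner ℝ (mulC ν φ h) f := by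
  rw [← cls_coeFn f, ← cls_coeFn h, inner_mulC hφ (Lp.memLp f) (Lp.memLp h),
    inner_mulC hφ (Lp.memLp h) (Lp.memLp f)]
  exact integral_congr_ae (.of_forall fun z => by simp only; ring)

/-- Classes of test functions supported in the open set `U`. -/
def testClasses (U : Set (X N)) (ν : Measure (X N)) : Set (Lp ℝ 2 ν) :=
  {d | ∃ φ : X N → ℝ, ContDiff ℝ ∞ φ ∧ HasCompactSupport φ ∧ tsupport φ ⊆ U ∧ d = cls ν φ}

theorem memLp_test [IsFiniteMeasureOnCompacts ν] {φ : X N → ℝ} (h1 : Continuous φ)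
    (h2 : HasCompactSupport φ) (q : ℝ≥0∞) : MemLp φ q ν :=
  h1.memLp_of_hasCompactSupport h2

/-- The fundamental lemma of the calculus of variations; it makes test functions a separating set
for `hasDerivWithinAt_of_inner`. -/
theorem eq_zero_of_testClasses {U : Set (X N)} (hU : IsOpen U) (x : Lp ℝ 2 (volume.restrict U))
    (h : ∀ d ∈ testClasses U (volume.restrict U), inner ℝ x d = 0) : x = 0 := by
  have hloc : LocallyIntegrableOn x U volume := by
    rw [locallyIntegrableOn_iff hU.isLocallyClosed]
    intro K hK hKc
    have hxK : MemLp x 2 (volume.restrict K) := by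
      have h1 := (Lp.memLp x).restrict K
      rwa [Measure.restrict_restrict hKc.measurableSet, inter_eq_left.2 hK] at h1
    have : IsFiniteMeasure (volume.restrict K) := ⟨by simpa using hKc.measure_lt_top⟩
    exact MemLp.integrable (by norm_num) hxK
  have key := hU.ae_eq_zero_of_integral_contDiff_smul_eq_zero hloc (μ := volume)
    fun φ h1 h2 h3 => by
      have h4 := h _ ⟨φ, h1, h2, h3, rfl⟩
      rw [← cls_coeFn x, inner_cls (Lp.memLp x) (memLp_test h1.continuous h2 2)] at h4
      rw [← h4, ← integral_indicator hU.measurableSet]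
      refine integral_congr_ae (.of_forall fun z => ?_)
      by_cases hz : z ∈ U
      · simp [hz, mul_comm]
      · have : φ z = 0 := image_eq_zero_of_notMem_tsupport fun hz' => hz (h3 hz')
        simp [hz, this]
  rw [← cls_coeFn x, ← cls_coeFn (0 : Lp ℝ 2 (volume.restrict U)),
    cls_eq_iff (Lp.memLp x) (Lp.memLp _)]
  filter_upwards [(ae_restrict_iff' hU.measurableSet).2 key,
    Lp.coeFn_zero ℝ 2 (volume.restrict U)] with z h1 h2
  rw [h1, h2]; rfl

end LpTools

end WaveEnergy

namespace WaveEnergy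

/-! ### Integration by parts for products of H¹ functions -/

section IntegrationByParts

variable {N : ℕ}

/-- The integral is the convolution of `k` with the reflection of `φ`, evaluated at `t • e`, and a
convolution is differentiated on its smooth factor. -/
theorem hasDerivAt_integral_mul_shift {k φ : X N → ℝ} (hk : LocallyIntegrable k volume)
    (hφ : ContDiff ℝ 1 φ) (hc : HasCompactSupport φ) (e : X N) (t : ℝ) :
    HasDerivAt (fun t : ℝ => ∫ x, k x * φ (x - t • e))
      (-∫ x, k x * fderiv ℝ φ (x - t • e) e) t := by
  set ψ : X N → ℝ := fun y => φ (-y) with hψ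
  have hψ1 : ContDiff ℝ 1 ψ := hφ.comp contDiff_neg
  have hψc : HasCompactSupport ψ := hc.comp_homeomorph (Homeomorph.neg (X N))
  have h1 := hψc.hasFDerivAt_convolution_right (ContinuousLinearMap.mul ℝ ℝ) hk hψ1 (t • e)
  have h2 : HasDerivAt (fun t : ℝ => t • e) e t := by
    simpa using (hasDerivAt_id t).smul_const e
  have h3 := h1.comp_hasDerivAt t h2
  rw [convolution_precompR_apply _ hk (hψc.fderiv ℝ) (hψ1.continuous_fderiv one_ne_zero)] at h3
  convert! h3 using 1
  · funext t
    simp [convolution, hψ]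
  · simp only [convolution, ContinuousLinearMap.mul_apply']
    rw [← integral_neg]
    refine integral_congr_ae (.of_forall fun x => ?_)
    have h4 : fderiv ℝ ψ (t • e - x) e = - fderiv ℝ φ (x - t • e) e := by
      have h5 : HasFDerivAt φ (fderiv ℝ φ (-(t • e - x))) (-(t • e - x)) :=
        (hφ.differentiable one_ne_zero _).hasFDerivAt
      have h6 := h5.comp (t • e - x) (hasFDerivAt_id (t • e - x)).neg
      have h7 : fderiv ℝ ψ (t • e - x) = _ := h6.fderiv
      rw [h7]
      simp
    simp only [h4]; ring

/-- The translate `x ↦ f (x + t e)` as a curve in `L²`. -/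
noncomputable def shiftCurve (e : X N) (f : X N → ℝ) (t : ℝ) : Lp ℝ 2 (volume : Measure (X N)) :=
  cls volume fun x => f (x + t • e)

theorem memLp_shift {f : X N → ℝ} (hf : MemLp f 2 volume) (e : X N) (t : ℝ) :
    MemLp (fun x => f (x + t • e)) 2 volume :=
  hf.comp_measurePreserving (measurePreserving_add_right volume (t • e))

theorem continuous_shiftCurve {f : X N → ℝ} (hf : MemLp f 2 volume) (e : X N) :
    Continuous (shiftCurve e f) := by
  have h1 : shiftCurve e f = fun t => Lp.compMeasurePreserving
      ((⟨fun x => x + t • e, by fun_prop⟩ : C(X N, X N)) : X N → X N)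
      (measurePreserving_add_right volume (t • e)) (cls volume f) := by
    funext t
    rw [shiftCurve, cls_eq (memLp_shift hf e t), cls_eq hf]
    exact (Lp.toLp_compMeasurePreserving hf (measurePreserving_add_right volume (t • e))).symm
  rw [h1]
  refine Continuous.compMeasurePreservingLp continuous_const ?_ _ (by norm_num)
  refine ContinuousMap.continuous_of_continuous_uncurry _ ?_
  simp only [Function.uncurry_def, ContinuousMap.coe_mk]
  fun_prop

/-- Against a test function the translation can be moved onto the test function, where
differentiation is classical and the definition of the weak derivative applies. Translations of `f'`
are continuous in L², so the weak derivative of the curve is a strong one. -/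
theorem hasDerivAt_shiftCurve {i : Fin N} {f f' : X N → ℝ} (hw : HasWeakPartial i f f')
    (hf : MemLp f 2 volume) (hf' : MemLp f' 2 volume) :
    HasDerivAt (shiftCurve (EuclideanSpace.single i 1) f)
      (shiftCurve (EuclideanSpace.single i 1) f' 0) 0 := by
  set e : X N := EuclideanSpace.single i 1
  have hsep : ∀ x : Lp ℝ 2 (volume : Measure (X N)),
      (∀ d ∈ testClasses univ volume, inner ℝ x d = 0) → x = 0 := by
    have := eq_zero_of_testClasses (N := N) isOpen_univ
    rwa [Measure.restrict_univ] at this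
  have key := hasDerivWithinAt_of_inner hsep (show (-1 : ℝ) < 1 by norm_num)
    (continuous_shiftCurve hf' e).continuousOn (f := shiftCurve e f) ?_ 0 (by norm_num)
  · exact key.hasDerivAt (Icc_mem_nhds (by norm_num) (by norm_num))
  rintro _ ⟨φ, h1, h2, -, rfl⟩ t -
  have hin : ∀ {k : X N → ℝ} (_ : MemLp k 2 volume) (t : ℝ),
      inner ℝ (shiftCurve e k t) (cls volume φ) = ∫ x, k x * φ (x - t • e) := by
    intro k hk t
    rw [shiftCurve, inner_cls (memLp_shift hk e t) (memLp_test h1.continuous h2 2),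
      ← integral_add_right_eq_self (fun x => k x * φ (x - t • e)) (t • e)]
    simp
  have h3 := hasDerivAt_integral_mul_shift hw.1 (h1.of_le (by simp)) h2 e t
  have h4 : -∫ x, f x * fderiv ℝ φ (x - t • e) e = ∫ x, f' x * φ (x - t • e) := by
    have h5 : ∫ x, f x * fderiv ℝ (fun x => φ (x - t • e)) x e =
        -∫ x, f' x * φ (x - t • e) :=
      hw.2.2 (fun x => φ (x - t • e)) (h1.comp (contDiff_id.sub contDiff_const))
      (h2.comp_homeomorph (Homeomorph.subRight (t • e)))
    simp only [fderiv_comp_sub] at h5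
    rw [h5, neg_neg]
  rw [h4] at h3
  simp only [hin hf, hin hf']
  exact h3.hasDerivWithinAt

/-- The function `t ↦ ∫ f h φ(· - te)` is differentiated at 0 in two ways: directly on `φ`, and,
after a change of variables, by the product rule for the translates of `f` and `h` in L². -/
theorem integral_fderiv_mul_mul_of_memLp {i : Fin N} {f f' h h' φ : X N → ℝ}
    (hwf : HasWeakPartial i f f') (hwh : HasWeakPartial i h h')
    (hf : MemLp f 2 volume) (hf' : MemLp f' 2 volume)
    (hh : MemLp h 2 volume) (hh' : MemLp h' 2 volume)
    (hφ : ContDiff ℝ 1 φ) (hc : HasCompactSupport φ) :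
    ∫ x, fderiv ℝ φ x (EuclideanSpace.single i 1) * f x * h x =
      -((∫ x, φ x * f' x * h x) + ∫ x, φ x * f x * h' x) := by
  set e : X N := EuclideanSpace.single i 1
  have hφL : MemLp φ ∞ volume := memLp_test hφ.continuous hc ∞
  have hd1 := hasDerivAt_shiftCurve hwf hf hf'
  have hd2 := hasDerivAt_shiftCurve hwh hh hh'
  have hd3 := ((mulC volume φ).hasFDerivAt.comp_hasDerivAt (0 : ℝ) hd1).inner ℝ hd2
  have hloc : LocallyIntegrable (fun x => f x * h x) volume :=
    (hf.integrable_mul hh).locallyIntegrable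
  have hd4 := hasDerivAt_integral_mul_shift hloc hφ hc e 0
  have hz : ∀ k : X N → ℝ, shiftCurve e k 0 = cls volume k := fun k => by simp [shiftCurve]
  have heq : (fun t : ℝ => ∫ x, f x * h x * φ (x - t • e)) =
      fun t => inner ℝ ((mulC volume φ ∘ shiftCurve e f) t) (shiftCurve e h t) := by
    funext t
    simp only [Function.comp_apply, shiftCurve]
    rw [inner_mulC hφL (memLp_shift hf e t) (memLp_shift hh e t),
      ← integral_add_right_eq_self (fun x => f x * h x * φ (x - t • e)) (t • e)]
    refine integral_congr_ae (.of_forall fun x => ?_)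
    simp only [add_sub_cancel_right]; ring
  rw [heq] at hd4
  have := hd4.unique hd3
  simp only [Function.comp_apply] at this
  rw [hz, hz, hz, hz, inner_mulC hφL hf hh', inner_mulC hφL hf' hh] at this
  rw [add_comm, ← this, neg_neg]
  refine integral_congr_ae (.of_forall fun x => ?_)
  simp only [zero_smul, sub_zero]; ring

theorem MemL2Loc.locallyIntegrable {f : X N → ℝ} (hf : MemL2Loc f) :
    LocallyIntegrable f volume := by
  rw [locallyIntegrable_iff]
  intro K hK
  obtain ⟨R, hR⟩ := hK.isBounded.subset_closedBall 0
  have : IsFiniteMeasure (volume.restrict (Metric.closedBall (0 : X N) R)) :=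
    ⟨by simpa using measure_closedBall_lt_top⟩
  have h1 : IntegrableOn f (Metric.closedBall 0 R) volume := MemLp.integrable (by norm_num) (hf R)
  exact h1.mono_set hR

theorem MemL2Loc.memLp_mul {f χ : X N → ℝ} (hf : MemL2Loc f) (h1 : Continuous χ)
    (h2 : HasCompactSupport χ) : MemLp (fun x => χ x * f x) 2 volume := by
  obtain ⟨R, hR⟩ := h2.isCompact.isBounded.subset_closedBall (0 : X N)
  have h3 : MemLp (fun x => χ x * f x) 2 (volume.restrict (Metric.closedBall 0 R)) :=
    (hf R).mul (memLp_test h1 h2 ∞)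
  rw [← memLp_indicator_iff_restrict measurableSet_closedBall] at h3
  convert h3 using 1
  funext x
  by_cases hx : x ∈ Metric.closedBall (0 : X N) R
  · simp [hx]
  · have : χ x = 0 := image_eq_zero_of_notMem_tsupport fun h => hx (hR h)
    simp [hx, this]

theorem HasWeakPartial.smooth_mul {i : Fin N} {f f' χ : X N → ℝ} (hw : HasWeakPartial i f f')
    (h1 : ContDiff ℝ ∞ χ) (h2 : HasCompactSupport χ) :
    HasWeakPartial i (fun x => χ x * f x)
      (fun x => fderiv ℝ χ x (EuclideanSpace.single i 1) * f x + χ x * f' x) := by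
  set e : X N := EuclideanSpace.single i 1
  have hdc : Continuous fun x => fderiv ℝ χ x e :=
    (h1.continuous_fderiv (by simp)).clm_apply continuous_const
  refine ⟨hw.1.continuous_mul h1.continuous, (hw.1.continuous_mul hdc).add
    (hw.2.1.continuous_mul h1.continuous), fun φ h3 h4 => ?_⟩
  have h5 : ∫ x, f x * fderiv ℝ (fun x => χ x * φ x) x e = -∫ x, f' x * (χ x * φ x) :=
    hw.2.2 (fun x => χ x * φ x) (h1.mul h3) (h2.mul_right)
  have hdφ : Continuous fun x => fderiv ℝ φ x e :=
    (h3.continuous_fderiv (by simp)).clm_apply continuous_const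
  have hfd : ∀ x, fderiv ℝ (fun x => χ x * φ x) x e
      = χ x * fderiv ℝ φ x e + φ x * fderiv ℝ χ x e := fun x => by
    rw [fderiv_fun_mul (h1.differentiable (by simp) x) (h3.differentiable (by simp) x)]
    simp
  have hi : ∀ {k ψ : X N → ℝ}, LocallyIntegrable k volume → Continuous ψ →
      HasCompactSupport ψ → Integrable (fun x => k x * ψ x) volume := by
    intro k ψ hk hψ hψc
    have := hk.integrable_smul_left_of_hasCompactSupport hψ hψc
    simpa [mul_comm] using this
  have i1 : Integrable (fun x => f x * (χ x * fderiv ℝ φ x e)) volume :=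
    hi hw.1 (h1.continuous.mul hdφ) h2.mul_right
  have i2 : Integrable (fun x => f x * (φ x * fderiv ℝ χ x e)) volume :=
    hi hw.1 (h3.continuous.mul hdc) h4.mul_right
  have i3 : Integrable (fun x => f' x * (χ x * φ x)) volume :=
    hi hw.2.1 (h1.continuous.mul h3.continuous) h2.mul_right
  simp only [hfd, mul_add] at h5
  rw [integral_add i1 i2] at h5
  have e1 : ∫ x, χ x * f x * fderiv ℝ φ x e = ∫ x, f x * (χ x * fderiv ℝ φ x e) :=
    integral_congr_ae (.of_forall fun x => by simp only; ring)
  have e2 : ∫ x, (fderiv ℝ χ x e * f x + χ x * f' x) * φ x =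
      (∫ x, f x * (φ x * fderiv ℝ χ x e)) + ∫ x, f' x * (χ x * φ x) := by
    rw [← integral_add i2 i3]
    exact integral_congr_ae (.of_forall fun x => by simp only; ring)
  rw [e1, e2]
  linarith

/-- Integration by parts for products of two functions in `H¹_loc` against a `C¹` weight. -/
theorem integral_fderiv_mul_mul {i : Fin N} {f f' h h' φ : X N → ℝ}
    (hwf : HasWeakPartial i f f') (hwh : HasWeakPartial i h h')
    (hf : MemL2Loc f) (hf' : MemL2Loc f') (hh : MemL2Loc h) (hh' : MemL2Loc h')
    (hφ : ContDiff ℝ 1 φ) {R : ℝ} (hR : 0 < R) (hc : tsupport φ ⊆ Metric.closedBall 0 R) :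
    ∫ x, fderiv ℝ φ x (EuclideanSpace.single i 1) * f x * h x =
      -((∫ x, φ x * f' x * h x) + ∫ x, φ x * f x * h' x) := by
  set e : X N := EuclideanSpace.single i 1
  -- The inner radius `R + 1` exceeds `R`, so the cutoff is 1 in a neighbourhood of the support of
  -- `φ` and its derivative vanishes there.
  let b : ContDiffBump (0 : X N) := ⟨R + 1, R + 2, by linarith, by linarith⟩
  have b1 : ContDiff ℝ ∞ b := b.contDiff
  have b2 : HasCompactSupport b := b.hasCompactSupport
  have hdc : Continuous fun x => fderiv ℝ b x e :=
    (b1.continuous_fderiv (by simp)).clm_apply continuous_const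
  have hdcs : HasCompactSupport fun x => fderiv ℝ b x e := b2.fderiv_apply ℝ e
  have hφc : HasCompactSupport φ :=
    (isCompact_closedBall 0 R).of_isClosed_subset (isClosed_tsupport φ) hc
  have key := integral_fderiv_mul_mul_of_memLp (hwf.smooth_mul b1 b2) (hwh.smooth_mul b1 b2)
    (hf.memLp_mul b1.continuous b2)
    ((hf.memLp_mul hdc hdcs).add (hf'.memLp_mul b1.continuous b2))
    (hh.memLp_mul b1.continuous b2)
    ((hh.memLp_mul hdc hdcs).add (hh'.memLp_mul b1.continuous b2)) hφ hφc
  have hb1 : ∀ x ∈ tsupport φ, b x = 1 := fun x hx =>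
    b.one_of_mem_closedBall (Metric.closedBall_subset_closedBall (by simp [b]) (hc hx))
  have hb0 : ∀ x ∈ tsupport φ, fderiv ℝ b x e = 0 := by
    intro x hx
    have : (b : X N → ℝ) =ᶠ[𝓝 x] fun _ => 1 := by
      refine b.eventuallyEq_one_of_mem_ball ?_
      refine Metric.closedBall_subset_ball ?_ (hc hx)
      simp [b]
    rw [this.fderiv_eq]; simp
  have hb0' : ∀ x ∈ tsupport φ, fderiv ℝ b x (EuclideanSpace.single i 1) = 0 := hb0
  refine Eq.trans (integral_congr_ae (.of_forall fun x => ?_)) (key.trans (congrArg Neg.neg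
    (congrArg₂ (· + ·) (integral_congr_ae (.of_forall fun x => ?_))
      (integral_congr_ae (.of_forall fun x => ?_)))))
  · by_cases hx : x ∈ tsupport φ
    · simp [hb1 x hx, e]
    · have : fderiv ℝ φ x = 0 :=
        image_eq_zero_of_notMem_tsupport fun h => hx (tsupport_fderiv_subset ℝ h)
      simp [this]
  all_goals
    by_cases hx : x ∈ tsupport φ
    · simp [hb1 x hx, hb0' x hx]
    · simp [image_eq_zero_of_notMem_tsupport hx]

end IntegrationByParts

end WaveEnergy

namespace WaveEnergy

/-! ### The weights on the ball and their integration by parts -/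

section Weights

variable {N : ℕ}

/-- Lebesgue measure on the unit ball. -/
noncomputable abbrev ballMeasure (N : ℕ) : Measure (X N) := volume.restrict (B N)

instance : IsFiniteMeasure (ballMeasure N) :=
  ⟨by simpa [B] using measure_closedBall_lt_top⟩

theorem memLp_top_of_continuous {φ : X N → ℝ} (hφ : Continuous φ) :
    MemLp φ ∞ (ballMeasure N) := by
  obtain ⟨C, hC⟩ := (isCompact_closedBall (0 : X N) 1).exists_bound_of_continuousOn hφ.continuousOn
  refine memLp_top_of_bound hφ.aestronglyMeasurable C ?_
  exact (ae_restrict_iff' measurableSet_closedBall).2 (.of_forall hC)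

/-- Away from 0 the function is locally zero or a power; at 0 it is dominated by `|x|^γ`, whose
derivative there vanishes because `γ > 1`. -/
theorem hasDerivAt_max_rpow {γ : ℝ} (hγ : 1 < γ) (x : ℝ) :
    HasDerivAt (fun x : ℝ => max 0 x ^ γ) (γ * max 0 x ^ (γ - 1)) x := by
  rcases lt_trichotomy x 0 with hx | rfl | hx
  · have h1 : (fun x : ℝ => max 0 x ^ γ) =ᶠ[𝓝 x] fun _ => 0 := by
      filter_upwards [Iio_mem_nhds hx] with y hy
      rw [max_eq_left (le_of_lt hy), Real.zero_rpow (by linarith)]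
    rw [max_eq_left hx.le, Real.zero_rpow (by linarith), mul_zero]
    exact (hasDerivAt_const x (0 : ℝ)).congr_of_eventuallyEq h1
  · have h1 := hasDerivAt_abs_rpow 0 hγ
    simp only [mul_zero] at h1
    rw [max_self, Real.zero_rpow (by linarith), mul_zero]
    rw [hasDerivAt_iff_isLittleO_nhds_zero] at h1 ⊢
    refine Asymptotics.IsBigO.trans_isLittleO (Asymptotics.IsBigO.of_bound 1 ?_) h1
    refine .of_forall fun y => ?_
    have h2 : max 0 y ^ γ ≤ |y| ^ γ :=
      Real.rpow_le_rpow (le_max_left _ _) (max_le (abs_nonneg _) (le_abs_self _)) (by linarith)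
    have h3 : 0 ≤ max 0 y ^ γ := Real.rpow_nonneg (le_max_left _ _) _
    have h4 : (0 : ℝ) ^ γ = 0 := Real.zero_rpow (by linarith)
    simp only [zero_add, max_self, abs_zero, h4, smul_zero, sub_zero, one_mul, Real.norm_eq_abs]
    rw [abs_of_nonneg h3]
    exact h2.trans (le_abs_self _)
  · have h1 : (fun x : ℝ => max 0 x ^ γ) =ᶠ[𝓝 x] fun x => x ^ γ := by
      filter_upwards [Ioi_mem_nhds hx] with y hy
      rw [max_eq_right (le_of_lt hy)]
    rw [max_eq_right hx.le]
    exact (Real.hasDerivAt_rpow_const (Or.inl hx.ne')).congr_of_eventuallyEq h1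

theorem contDiff_max_rpow {γ : ℝ} (hγ : 1 < γ) : ContDiff ℝ 1 fun x : ℝ => max 0 x ^ γ := by
  refine contDiff_one_iff_deriv.2 ⟨fun x => (hasDerivAt_max_rpow hγ x).differentiableAt, ?_⟩
  rw [funext fun x => (hasDerivAt_max_rpow hγ x).deriv]
  exact continuous_const.mul
    ((continuous_const.max continuous_id).rpow_const fun _ => Or.inr (by linarith))

/-- The weight `ρ^γ`, extended by zero outside the unit ball. -/
noncomputable def cutRho (γ : ℝ) (z : X N) : ℝ := max 0 (rho z) ^ γ

theorem rho_nonneg {z : X N} (hz : z ∈ B N) : 0 ≤ rho z := by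
  have : ‖z‖ ≤ 1 := by simpa [B] using hz
  have h2 : ‖z‖ ^ 2 ≤ 1 := pow_le_one₀ (norm_nonneg _) this
  simp only [rho]; linarith

theorem cutRho_eq {γ : ℝ} {z : X N} (hz : z ∈ B N) : cutRho γ z = rho z ^ γ := by
  rw [cutRho, max_eq_right (rho_nonneg hz)]

theorem cutRho_eq_zero {γ : ℝ} (hγ : 0 < γ) {z : X N} (hz : z ∉ B N) : cutRho γ z = 0 := by
  have : 1 < ‖z‖ := by simpa [B] using hz
  have h2 : 1 < ‖z‖ ^ 2 := one_lt_pow₀ this (by norm_num)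
  rw [cutRho, max_eq_left (by simp only [rho]; linarith), Real.zero_rpow hγ.ne']

theorem tsupport_subset_of_eq_zero {φ : X N → ℝ} (h : ∀ z ∉ B N, φ z = 0) :
    tsupport φ ⊆ Metric.closedBall 0 1 :=
  closure_minimal (fun z hz => by_contra fun hz' => hz (h z hz')) Metric.isClosed_closedBall

theorem contDiff_rho : ContDiff ℝ ∞ (rho : X N → ℝ) :=
  contDiff_const.sub (contDiff_norm_sq ℝ)

theorem contDiff_cutRho {γ : ℝ} (hγ : 1 < γ) : ContDiff ℝ 1 (cutRho γ : X N → ℝ) :=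
  (contDiff_max_rpow hγ).comp (contDiff_rho.of_le (by simp))

theorem hasFDerivAt_rho (z : X N) :
    HasFDerivAt (rho : X N → ℝ) (-((2 : ℝ) • innerSL ℝ z)) z := by
  have := ((hasStrictFDerivAt_norm_sq z).hasFDerivAt).const_sub (1 : ℝ)
  rw [show ((2 : ℝ) • innerSL ℝ z) = (2 : ℕ) • innerSL ℝ z by rw [two_smul, two_nsmul]]
  exact this

theorem fderiv_cutRho {γ : ℝ} (hγ : 1 < γ) (z : X N) (i : Fin N) :
    fderiv ℝ (cutRho γ) z (EuclideanSpace.single i 1) = -2 * γ * (z i * cutRho (γ - 1) z) := by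
  have h1 := (hasDerivAt_max_rpow hγ (rho z)).comp_hasFDerivAt z (hasFDerivAt_rho z)
  have h2 : fderiv ℝ (cutRho γ) z = _ := h1.fderiv
  rw [h2]
  simp [cutRho, EuclideanSpace.inner_single_right]
  ring

theorem continuous_rho_rpow {γ : ℝ} (hγ : 0 ≤ γ) : Continuous fun z : X N => rho z ^ γ :=
  (contDiff_rho.continuous).rpow_const fun _ => Or.inr hγ

theorem integral_ball_eq {F G : X N → ℝ} (h1 : ∀ z ∈ B N, F z = G z) (h2 : ∀ z ∉ B N, F z = 0) :
    ∫ z, F z = ∫ z in B N, G z := by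
  rw [← setIntegral_eq_integral_of_forall_compl_eq_zero h2]
  exact setIntegral_congr_fun measurableSet_closedBall h1

/-- The weight `ρ^γ`, as a multiplication operator on `L²(B)`. -/
noncomputable def rhoMul (N : ℕ) (γ : ℝ) : Lp ℝ 2 (ballMeasure N) →L[ℝ] Lp ℝ 2 (ballMeasure N) :=
  mulC (ballMeasure N) fun z => rho z ^ γ

/-- The weight `z_i ρ^γ`, as a multiplication operator on `L²(B)`. -/
noncomputable def coordMul (γ : ℝ) (i : Fin N) :
    Lp ℝ 2 (ballMeasure N) →L[ℝ] Lp ℝ 2 (ballMeasure N) :=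
  mulC (ballMeasure N) fun z => z i * rho z ^ γ

/-- The weight `div (ρ^γ z)`, as a multiplication operator on `L²(B)`. -/
noncomputable def divMul (N : ℕ) (γ : ℝ) : Lp ℝ 2 (ballMeasure N) →L[ℝ] Lp ℝ 2 (ballMeasure N) :=
  mulC (ballMeasure N) fun z => (N * rho z - 2 * γ * ‖z‖ ^ 2) * rho z ^ (γ - 1)

theorem memLp_rho {γ : ℝ} (hγ : 0 ≤ γ) : MemLp (fun z : X N => rho z ^ γ) ∞ (ballMeasure N) :=
  memLp_top_of_continuous (continuous_rho_rpow hγ)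

theorem memLp_coord {γ : ℝ} (hγ : 0 ≤ γ) (i : Fin N) :
    MemLp (fun z : X N => z i * rho z ^ γ) ∞ (ballMeasure N) :=
  memLp_top_of_continuous (.mul (by fun_prop) (continuous_rho_rpow hγ))

theorem memLp_div {γ : ℝ} (hγ : 1 ≤ γ) :
    MemLp (fun z : X N => (N * rho z - 2 * γ * ‖z‖ ^ 2) * rho z ^ (γ - 1)) ∞ (ballMeasure N) :=
  memLp_top_of_continuous (.mul (.sub (continuous_const.mul contDiff_rho.continuous)
    (by fun_prop)) (continuous_rho_rpow (by linarith)))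

/-- The zero extension of `ρ^α` is C¹ with gradient `-2α ρ^{α-1} z`, so integrating by parts on the
whole space leaves no boundary term on the sphere. -/
theorem inner_rhoMul_partial {α : ℝ} (hα : 1 < α) {i : Fin N} {f f' h h' : X N → ℝ}
    (hwf : HasWeakPartial i f f') (hwh : HasWeakPartial i h h')
    (hf : MemL2Loc f) (hf' : MemL2Loc f') (hh : MemL2Loc h) (hh' : MemL2Loc h') :
    2 * α * inner ℝ (coordMul (α - 1) i (cls (ballMeasure N) f)) (cls (ballMeasure N) h) =
      inner ℝ (rhoMul N α (cls (ballMeasure N) f')) (cls (ballMeasure N) h) +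
      inner ℝ (rhoMul N α (cls (ballMeasure N) f)) (cls (ballMeasure N) h') := by
  have hz : ∀ z ∉ B N, cutRho α z = 0 := fun z hz => cutRho_eq_zero (by linarith) hz
  have key := integral_fderiv_mul_mul hwf hwh hf hf' hh hh' (contDiff_cutRho hα) one_pos
    (tsupport_subset_of_eq_zero hz)
  simp only [fderiv_cutRho hα] at key
  rw [integral_ball_eq (G := fun z => -2 * α * (z i * rho z ^ (α - 1) * f z * h z))
      (fun z hz => by rw [cutRho_eq hz]; ring)
      (fun z hz => by rw [cutRho_eq_zero (by linarith) hz]; ring),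
    integral_ball_eq (G := fun z => rho z ^ α * f' z * h z)
      (fun z hz => by rw [cutRho_eq hz]) (fun z hz => by rw [cutRho_eq_zero (by linarith) hz]; ring),
    integral_ball_eq (G := fun z => rho z ^ α * f z * h' z)
      (fun z hz => by rw [cutRho_eq hz]) (fun z hz => by rw [cutRho_eq_zero (by linarith) hz]; ring),
    integral_const_mul] at key
  rw [coordMul, rhoMul, inner_mulC (memLp_coord (by linarith) i) (hf 1) (hh 1),
    inner_mulC (memLp_rho (by linarith)) (hf' 1) (hh 1),
    inner_mulC (memLp_rho (by linarith)) (hf 1) (hh' 1)]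
  linarith

/-- Integration by parts against each C¹ weight `z_i ρ^γ`, summed over `i`. It is applied with `γ =
α - 1`, so the condition `γ > 1` is `α > 2`. -/
theorem inner_divMul {γ : ℝ} (hγ : 1 < γ) {f h : X N → ℝ} {f' h' : Fin N → X N → ℝ}
    (hwf : ∀ i, HasWeakPartial i f (f' i)) (hwh : ∀ i, HasWeakPartial i h (h' i))
    (hf : MemL2Loc f) (hf' : ∀ i, MemL2Loc (f' i)) (hh : MemL2Loc h)
    (hh' : ∀ i, MemL2Loc (h' i)) :
    inner ℝ (divMul N γ (cls (ballMeasure N) f)) (cls (ballMeasure N) h) =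
      -∑ i, (inner ℝ (coordMul γ i (cls (ballMeasure N) (f' i))) (cls (ballMeasure N) h) +
      inner ℝ (coordMul γ i (cls (ballMeasure N) f)) (cls (ballMeasure N) (h' i))) := by
  have hcomp : ∀ i, ∫ z in B N, (rho z ^ γ - 2 * γ * (z i ^ 2 * rho z ^ (γ - 1))) * f z * h z =
      -(inner ℝ (coordMul γ i (cls (ballMeasure N) (f' i))) (cls (ballMeasure N) h) +
      inner ℝ (coordMul γ i (cls (ballMeasure N) f)) (cls (ballMeasure N) (h' i))) := by
    intro i
    set φ : X N → ℝ := fun z => z i * cutRho γ z with hφ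
    have hcoord : ContDiff ℝ 1 fun z : X N => z i := by fun_prop
    have hφ1 : ContDiff ℝ 1 φ := hcoord.mul (contDiff_cutRho hγ)
    have hz : ∀ z ∉ B N, φ z = 0 := fun z hz => by
      simp [hφ, cutRho_eq_zero (by linarith : 0 < γ) hz]
    have hd : ∀ z, fderiv ℝ φ z (EuclideanSpace.single i 1) =
        cutRho γ z - 2 * γ * (z i ^ 2 * cutRho (γ - 1) z) := by
      intro z
      rw [hφ, fderiv_fun_mul (hcoord.differentiable one_ne_zero z)
        ((contDiff_cutRho hγ).differentiable one_ne_zero z)]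
      have h1 : fderiv ℝ (fun z : X N => z i) z (EuclideanSpace.single i 1) = 1 := by
        have h2 : HasFDerivAt (fun z : X N => z i) (EuclideanSpace.proj i : X N →L[ℝ] ℝ) z :=
          (EuclideanSpace.proj i : X N →L[ℝ] ℝ).hasFDerivAt
        rw [h2.fderiv]; simp
      simp only [add_apply, smul_apply, h1,
        fderiv_cutRho hγ, smul_eq_mul]
      ring
    have key := integral_fderiv_mul_mul (hwf i) (hwh i) hf (hf' i) hh (hh' i) hφ1 one_pos
      (tsupport_subset_of_eq_zero hz)
    simp only [hd] at key
    simp only [hφ] at key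
    rw [integral_ball_eq
        (G := fun z => (rho z ^ γ - 2 * γ * (z i ^ 2 * rho z ^ (γ - 1))) * f z * h z)
        (fun z hz => by rw [cutRho_eq hz, cutRho_eq hz])
        (fun z hz => by
          rw [cutRho_eq_zero (by linarith) hz, cutRho_eq_zero (by linarith) hz]; ring),
      integral_ball_eq (G := fun z => z i * rho z ^ γ * f' i z * h z)
        (fun z hz => by rw [cutRho_eq hz])
        (fun z hz => by rw [cutRho_eq_zero (by linarith) hz]; ring),
      integral_ball_eq (G := fun z => z i * rho z ^ γ * f z * h' i z)
        (fun z hz => by rw [cutRho_eq hz])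
        (fun z hz => by rw [cutRho_eq_zero (by linarith) hz]; ring)] at key
    rw [coordMul, inner_mulC (memLp_coord (by linarith) i) (hf' i 1) (hh 1),
      inner_mulC (memLp_coord (by linarith) i) (hf 1) (hh' i 1)]
    exact key
  rw [divMul, inner_mulC (memLp_div hγ.le) (hf 1) (hh 1), ← Finset.sum_neg_distrib,
    ← Finset.sum_congr rfl fun i _ => hcomp i, ← integral_finsetSum]
  · refine setIntegral_congr_fun measurableSet_closedBall fun z hz => ?_
    -- On the sphere `ρ = 0` the exponent rule is unavailable, and both sides vanish.
    have h1 : rho z ^ γ = rho z * rho z ^ (γ - 1) := by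
      rcases (rho_nonneg hz).eq_or_lt with h0 | h0
      · rw [← h0, Real.zero_rpow (by linarith), zero_mul]
      · rw [Real.rpow_sub_one h0.ne']; field_simp
    have h2 : ‖z‖ ^ 2 = ∑ i, z i ^ 2 := by
      rw [EuclideanSpace.norm_sq_eq]; simp
    simp only
    rw [← Finset.sum_mul, ← Finset.sum_mul, Finset.sum_sub_distrib, ← Finset.mul_sum,
      ← Finset.sum_mul, ← h2, h1]
    simp only [Finset.sum_const, Finset.card_univ, Fintype.card_fin, nsmul_eq_mul]
    ring
  · intro i _
    refine integrable_mul_mul (memLp_top_of_continuous ?_) (hf 1) (hh 1)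
    exact .sub (continuous_rho_rpow (by linarith)) (continuous_const.mul (.mul (by fun_prop)
      (continuous_rho_rpow (by linarith))))

end Weights

end WaveEnergy

namespace WaveEnergy

/-! ### Abstract differentiation of the energy at low regularity -/

section EnergyCalculus

variable {H : Type*} [NormedAddCommGroup H] [InnerProductSpace ℝ H]

/-- A factor that vanishes at `s` needs only a continuous partner: the difference quotient is the
slope of `f` paired with `k(r)`. -/
theorem hasDerivWithinAt_inner_sub {I : Set ℝ} {s : ℝ} {f k : ℝ → H} {f' : H}
    (hf : HasDerivWithinAt f f' I s) (hk : ContinuousWithinAt k I s) :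
    HasDerivWithinAt (fun r => inner ℝ (f r - f s) (k r)) (inner ℝ f' (k s)) I s := by
  rw [hasDerivWithinAt_iff_tendsto_slope] at hf ⊢
  have h := hf.inner (𝕜 := ℝ) (hk.mono (sdiff_subset (t := {s})))
  refine h.congr fun r => ?_
  simp [slope, inner_smul_left]

/-- The subgradient inequality, used from `s` to `r` and from `r` to `s`, traps the linearization
error between 0 and `⟨F r - F s, Θ r - Θ s⟩`. This bound is `o(r - s)`, since `F` is continuous and
`Θ` differentiable at `s`. -/
theorem hasDerivWithinAt_of_subgradient {I : Set ℝ} {s : ℝ} (hs : s ∈ I) {P : ℝ → ℝ}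
    {F Θ : ℝ → H} {Θ' : H} (hF : ContinuousWithinAt F I s) (hΘ : HasDerivWithinAt Θ Θ' I s)
    (hP : ∀ r ∈ I, ∀ r' ∈ I, inner ℝ (F r) (Θ r' - Θ r) ≤ P r' - P r) :
    HasDerivWithinAt P (inner ℝ (F s) Θ') I s := by
  have h1 := hasDerivWithinAt_inner_sub hΘ (hF.sub_const (F s))
  rw [sub_self, inner_zero_right] at h1
  have h2 : HasDerivWithinAt (fun r => inner ℝ (F s) (Θ r - Θ s)) (inner ℝ (F s) Θ') I s := by
    simpa [real_inner_comm] using hasDerivWithinAt_inner_sub hΘ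
      (continuousWithinAt_const (b := F s))
  have h3 : HasDerivWithinAt (fun r => P r - P s - inner ℝ (F s) (Θ r - Θ s)) 0 I s := by
    rw [hasDerivWithinAt_iff_isLittleO] at h1 ⊢
    refine Asymptotics.IsBigO.trans_isLittleO (Asymptotics.IsBigO.of_bound 1 ?_) h1
    filter_upwards [self_mem_nhdsWithin] with r hr
    have a1 := hP s hs r hr
    have a2 := hP r hr s hs
    rw [← neg_sub (Θ r), inner_neg_right] at a2
    simp only [sub_self, inner_zero_right, smul_zero, sub_zero, one_mul, Real.norm_eq_abs]
    have a3 : inner ℝ (Θ r - Θ s) (F r - F s) =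
        inner ℝ (F r) (Θ r - Θ s) - inner ℝ (F s) (Θ r - Θ s) := by
      rw [inner_sub_right, real_inner_comm, real_inner_comm (F s)]
    rw [a3, abs_of_nonneg (by linarith)]
    exact le_trans (by linarith) (le_abs_self _)
  have h4 := (h3.add h2).add_const (P s)
  rw [zero_add] at h4
  convert! h4 using 1
  funext r
  simp

/-- Differentiation of the part of the energy without time integrals. -/
theorem hasDerivWithinAt_energy_core {ι : Type*} [Fintype ι] {I : Set ℝ} {s : ℝ} (hs : s ∈ I)
    {R V : H →L[ℝ] H} {C : ι → H →L[ℝ] H} (hR : ∀ f h, inner ℝ (R f) h = inner ℝ (R h) f)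
    {Θ L F : ℝ → H} {Θ' : H} {W' Ψ : ι → ℝ → H} {P γ : ℝ → ℝ} {β p α γ₂ : ℝ} (hp : 0 < p)
    (hΘ : HasDerivWithinAt Θ Θ' I s) (hΨ : ∀ i, ContinuousWithinAt (Ψ i) I s)
    (hW : ∀ i, HasDerivWithinAt (W' i) (γ₂ • Ψ i s) I s)
    (hF : ContinuousWithinAt F I s)
    (hP : ∀ r ∈ I, ∀ r' ∈ I, (p + 1) * inner ℝ (R (F r)) (Θ r' - Θ r) ≤ P r' - P r)
    (hγ : HasDerivWithinAt γ ((β + 1) * γ s) I s)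
    (heq : γ s • F s = γ s • (Θ' + β • Θ s) - L s)
    (hibp : ∀ r ∈ I, ∑ i, inner ℝ (R (W' i s)) (Ψ i r) -
      2 * α * ∑ i, inner ℝ (C i (W' i s)) (Θ r) = -inner ℝ (R (L s)) (Θ r))
    (hdiv : inner ℝ (V (Θ s)) (Θ s) = -(2 * ∑ i, inner ℝ (C i (Ψ i s)) (Θ s))) :
    HasDerivWithinAt (fun s => β / 2 * (γ s * inner ℝ (R (Θ s)) (Θ s)) - 1 / (p + 1) * (γ s * P s)
      + (∑ i, inner ℝ (R (W' i s)) (Ψ i s) - 2 * α * ∑ i, inner ℝ (C i (W' i s)) (Θ s)))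
      (-((β + 1) / (p + 1)) * (γ s * P s) - γ s * inner ℝ (R Θ') Θ'
        + β * (β + 1) / 2 * (γ s * inner ℝ (R (Θ s)) (Θ s))
        + γ₂ * ∑ i, inner ℝ (R (Ψ i s)) (Ψ i s) + α * (γ₂ * inner ℝ (V (Θ s)) (Θ s))) I s := by
  have hRΘ : HasDerivWithinAt (fun s => R (Θ s)) (R Θ') I s :=
    R.hasFDerivAt.comp_hasDerivWithinAt s hΘ
  have d1 := (hγ.mul (hRΘ.inner ℝ hΘ)).const_mul (β / 2)
  have dP : HasDerivWithinAt P (inner ℝ ((p + 1) • R (F s)) Θ') I s :=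
    hasDerivWithinAt_of_subgradient hs (F := fun r => (p + 1) • R (F r))
      ((R.continuous.continuousAt.comp_continuousWithinAt hF).const_smul _) hΘ
      (fun r hr r' hr' => by rw [inner_smul_left]; exact hP r hr r' hr')
  have d2 := (hγ.mul dP).const_mul (1 / (p + 1))
  have hRW : ∀ (A : H →L[ℝ] H) (i : ι),
      HasDerivWithinAt (fun s => A (W' i s)) (A (γ₂ • Ψ i s)) I s :=
    fun A i => A.hasFDerivAt.comp_hasDerivWithinAt s (hW i)
  -- `Ψ` is merely continuous, so `W'` is split into its increment from `s` and its frozen value.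
  -- The increments are treated here and in `d4`; by `hibp` the frozen parts add up to the pairing
  -- of `L s` with `Θ r`, differentiated in `d5`.
  have d3 : HasDerivWithinAt (fun r => ∑ i, inner ℝ (R (W' i r) - R (W' i s)) (Ψ i r))
      (∑ i, inner ℝ (R (γ₂ • Ψ i s)) (Ψ i s)) I s :=
    HasDerivWithinAt.fun_sum fun i _ => hasDerivWithinAt_inner_sub (hRW R i) (hΨ i)
  have d4 : HasDerivWithinAt (fun r => ∑ i, inner ℝ (C i (W' i r) - C i (W' i s)) (Θ r))
      (∑ i, inner ℝ (C i (γ₂ • Ψ i s)) (Θ s)) I s :=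
    HasDerivWithinAt.fun_sum fun i _ =>
      hasDerivWithinAt_inner_sub (hRW (C i) i) hΘ.continuousWithinAt
  have d5 : HasDerivWithinAt (fun r => -inner ℝ (R (L s)) (Θ r)) (-inner ℝ (R (L s)) Θ') I s := by
    simpa using ((hasDerivWithinAt_const s I (R (L s))).inner ℝ hΘ).fun_neg
  have d := ((d1.sub d2).add ((d3.sub (d4.const_mul (2 * α))).add d5))
  refine (d.congr_of_mem (fun r hr => ?_) hs).congr_deriv ?_
  · simp only [Pi.add_apply, Pi.sub_apply, Pi.mul_apply, ← hibp r hr, inner_sub_left,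
      Finset.sum_sub_distrib]
    ring
  -- The equation, paired with the weighted `Θ'`: the potential term cancels both the mass cross
  -- term and the frozen Laplacian, leaving the square of `Θ'`.
  · have e1 : γ s * inner ℝ (R (F s)) Θ' = γ s * inner ℝ (R Θ') Θ'
        + γ s * β * inner ℝ (R (Θ s)) Θ' - inner ℝ (R (L s)) Θ' := by
      rw [← real_inner_smul_left, ← map_smul, heq]
      simp only [map_sub, map_smul, map_add, inner_sub_left, inner_add_left, inner_smul_left]
      simp
      ring
    have e2 : inner ℝ (R Θ') (Θ s) = inner ℝ (R (Θ s)) Θ' := hR _ _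
    have e3 : ∑ i, inner ℝ (R (γ₂ • Ψ i s)) (Ψ i s) = γ₂ * ∑ i, inner ℝ (R (Ψ i s)) (Ψ i s) := by
      simp [Finset.mul_sum, inner_smul_left]
    have e4 : ∑ i, inner ℝ (C i (γ₂ • Ψ i s)) (Θ s) = γ₂ * ∑ i, inner ℝ (C i (Ψ i s)) (Θ s) := by
      simp [Finset.mul_sum, inner_smul_left]
    have hp1 : p + 1 ≠ 0 := by linarith
    have e5 : 1 / (p + 1) * ((β + 1) * γ s * P s + γ s * inner ℝ ((p + 1) • R (F s)) Θ') =
        (β + 1) / (p + 1) * (γ s * P s) + γ s * inner ℝ (R (F s)) Θ' := by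
      rw [real_inner_smul_left]; field_simp
    rw [e3, e4, e5, e1, e2, hdiv]
    ring

end EnergyCalculus

end WaveEnergy

namespace WaveEnergy

/-! ### Translations, and local Sobolev regularity as regularity of curves in L² -/

section Translation

variable {N : ℕ}

theorem HasWeakPartial.ae_unique {i : Fin N} {f g₁ g₂ : X N → ℝ} (h₁ : HasWeakPartial i f g₁)
    (h₂ : HasWeakPartial i f g₂) : g₁ =ᵐ[volume] g₂ := by
  refine ae_eq_of_integral_contDiff_smul_eq h₁.2.1 h₂.2.1 fun φ hφ hc => ?_
  have e1 := h₁.2.2 φ hφ hc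
  have e2 := h₂.2.2 φ hφ hc
  simp only [smul_eq_mul, mul_comm (φ _)]
  linarith

theorem HasWeakPartial.congr {i : Fin N} {f f' k k' : X N → ℝ} (h : HasWeakPartial i f k)
    (hf : f =ᵐ[volume] f') (hk : k =ᵐ[volume] k') : HasWeakPartial i f' k' := by
  refine ⟨h.1.congr hf, h.2.1.congr hk, fun φ hφ hc => ?_⟩
  have e1 := integral_congr_ae
    (hf.mul (ae_eq_refl fun x => fderiv ℝ φ x (EuclideanSpace.single i 1)))
  have e2 := integral_congr_ae (hk.mul (ae_eq_refl φ))
  exact e1.symm.trans ((h.2.2 φ hφ hc).trans (congrArg Neg.neg e2))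

theorem HasWeakPartial.const_mul {i : Fin N} {f k : X N → ℝ} (h : HasWeakPartial i f k) (c : ℝ) :
    HasWeakPartial i (fun z => c * f z) fun z => c * k z := by
  refine ⟨h.1.smul c, h.2.1.smul c, fun φ hφ hc => ?_⟩
  simp only [mul_assoc, integral_const_mul, h.2.2 φ hφ hc]
  ring

theorem measurePreserving_translate (a : X N) :
    MeasurePreserving (fun z => a + z) (volume : Measure (X N)) volume :=
  measurePreserving_add_left volume a

theorem LocallyIntegrable.translate {f : X N → ℝ} (hf : LocallyIntegrable f volume) (a : X N) :
    LocallyIntegrable (fun z => f (a + z)) volume := by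
  rw [locallyIntegrable_iff] at hf ⊢
  intro K hK
  have h1 : IntegrableOn f ((fun z => a + z) '' K) volume :=
    hf _ (hK.image (continuous_const.add continuous_id))
  exact ((measurePreserving_translate a).integrableOn_image
    (MeasurableEquiv.addLeft a).measurableEmbedding).1 h1

theorem HasWeakPartial.translate {i : Fin N} {f k : X N → ℝ} (h : HasWeakPartial i f k) (a : X N) :
    HasWeakPartial i (fun z => f (a + z)) fun z => k (a + z) := by
  refine ⟨LocallyIntegrable.translate h.1 a, LocallyIntegrable.translate h.2.1 a,
    fun φ hφ hc => ?_⟩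
  have h1 := h.2.2 (fun x => φ (x - a)) (hφ.comp (contDiff_id.sub contDiff_const))
    (hc.comp_homeomorph (Homeomorph.subRight a))
  simp only [fderiv_comp_sub] at h1
  rw [← integral_add_left_eq_self _ a, ← integral_add_left_eq_self (fun x => k x * φ (x - a)) a]
    at h1
  simpa using h1

theorem hasWeakPartial_weakPartial {i : Fin N} {f : X N → ℝ} (h : ∃ k, HasWeakPartial i f k) :
    HasWeakPartial i f (weakPartial i f) := by
  rw [weakPartial, dif_pos h]; exact h.choose_spec

theorem HasWeakPartial.weakPartial_ae_eq {i : Fin N} {f k : X N → ℝ} (h : HasWeakPartial i f k) :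
    weakPartial i f =ᵐ[volume] k :=
  (hasWeakPartial_weakPartial ⟨k, h⟩).ae_unique h

/-- Lebesgue measure on the ball of radius `R`. -/
noncomputable abbrev ballMeas (N : ℕ) (R : ℝ) : Measure (X N) :=
  volume.restrict (Metric.closedBall 0 R)

theorem MemL2Loc.congr {f f' : X N → ℝ} (h : MemL2Loc f) (e : f =ᵐ[volume] f') : MemL2Loc f' :=
  fun R => (memLp_congr_ae (ae_restrict_of_ae e)).1 (h R)

theorem MemL2Loc.const_mul {f : X N → ℝ} (h : MemL2Loc f) (c : ℝ) :
    MemL2Loc fun z => c * f z := fun R => (h R).const_mul c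

theorem measurePreserving_translate_restrict (a : X N) (R : ℝ) :
    MeasurePreserving (fun z => a + z) (ballMeas N R)
      (volume.restrict (Metric.closedBall a R)) := by
  have h1 := (measurePreserving_translate a).restrict_preimage
    (measurableSet_closedBall (x := a) (ε := R))
  have h2 : (fun z => a + z) ⁻¹' Metric.closedBall a R = Metric.closedBall (0 : X N) R := by
    ext z; simp [dist_eq_norm]
  rwa [h2] at h1

theorem restrict_closedBall_le (a : X N) (R : ℝ) :
    volume.restrict (Metric.closedBall a R) ≤ ballMeas N (‖a‖ + R) :=
  Measure.restrict_mono (Metric.closedBall_subset_closedBall' (by simp [add_comm])) le_rfl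

theorem MemL2Loc.translate {f : X N → ℝ} (h : MemL2Loc f) (a : X N) :
    MemL2Loc fun z => f (a + z) := fun R =>
  ((h (‖a‖ + R)).mono_measure (restrict_closedBall_le a R)).comp_measurePreserving
    (measurePreserving_translate_restrict a R)

theorem eLpNorm_translate_le {f : X N → ℝ} (h : MemL2Loc f) (a : X N) (R : ℝ) :
    eLpNorm (fun z => f (a + z)) 2 (ballMeas N R) ≤ eLpNorm f 2 (ballMeas N (‖a‖ + R)) := by
  have h1 := ((h (‖a‖ + R)).mono_measure (restrict_closedBall_le a R)).aestronglyMeasurable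
  have h2 := eLpNorm_comp_measurePreserving (p := 2) h1 (measurePreserving_translate_restrict a R)
  rw [show (fun z => f (a + z)) = f ∘ fun z => a + z from rfl, h2]
  exact eLpNorm_mono_measure _ (restrict_closedBall_le a R)

theorem edist_cls {ν : Measure (X N)} {f h : X N → ℝ} (hf : MemLp f 2 ν) (hh : MemLp h 2 ν) :
    edist (cls ν f) (cls ν h) = eLpNorm (f - h) 2 ν := by
  rw [cls_eq hf, cls_eq hh, Lp.edist_toLp_toLp]

/-- Passing to classes in L² on each ball makes the continuity and differentiation theorems for
curves in a normed space available; `hasTimeDeriv_iff` does the same for time derivatives. -/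
theorem continuousIntoHLoc_zero_iff {I : Set ℝ} {f : ℝ → X N → ℝ} :
    ContinuousIntoHLoc 0 I f ↔ (∀ t ∈ I, MemL2Loc (f t)) ∧
      ∀ R, ContinuousOn (fun t => cls (ballMeas N R) (f t)) I := by
  have key : (∀ t ∈ I, MemL2Loc (f t)) → ∀ t ∈ I, ∀ R,
      (Tendsto (fun t' => eLpNorm (f t' - f t) 2 (ballMeas N R)) (𝓝[I] t) (𝓝 0) ↔
        ContinuousWithinAt (fun t => cls (ballMeas N R) (f t)) I t) := by
    intro hf t ht R
    rw [ContinuousWithinAt, tendsto_iff_edist_tendsto_0]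
    refine tendsto_congr' ?_
    filter_upwards [self_mem_nhdsWithin] with r hr
    rw [edist_cls (hf r hr R) (hf t ht R)]
  rw [ContinuousIntoHLoc]
  constructor
  · intro h
    exact ⟨fun t ht => (h t ht).1, fun R t ht =>
      (key (fun t ht => (h t ht).1) t ht R).1 ((h t ht).2 R)⟩
  · rintro ⟨h1, h2⟩ t ht
    exact ⟨h1 t ht, fun R => (key h1 t ht R).2 (h2 R t ht)⟩

theorem hasTimeDeriv_iff {I : Set ℝ} {f : ℝ → X N → ℝ} {w : X N → ℝ} {t : ℝ}
    (hf : ∀ t ∈ I, MemL2Loc (f t)) (ht : t ∈ I) :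
    HasTimeDeriv I f w t ↔ MemL2Loc w ∧
      ∀ R, HasDerivWithinAt (fun t => cls (ballMeas N R) (f t)) (cls (ballMeas N R) w) I t := by
  refine and_congr_right fun hw => forall_congr' fun R => ?_
  rw [hasDerivWithinAt_iff_tendsto_slope, tendsto_iff_edist_tendsto_0]
  refine tendsto_congr' ?_
  filter_upwards [self_mem_nhdsWithin] with r hr
  have h1 : MemLp (fun x => f r x - f t x) 2 (ballMeas N R) := (hf r hr.1 R).sub (hf t ht R)
  rw [slope_def_module, ← cls_sub (hf r hr.1 R) (hf t ht R), ← cls_smul _ h1,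
    edist_cls (h1.const_mul _) (hw R)]
  rfl

theorem ContinuousIntoHLoc.translate {I : Set ℝ} {f : ℝ → X N → ℝ}
    (h : ContinuousIntoHLoc 0 I f) (a : X N) :
    ContinuousIntoHLoc 0 I fun t z => f t (a + z) := by
  rw [ContinuousIntoHLoc] at h ⊢
  refine fun t ht => ⟨(h t ht).1.translate a, fun R => ?_⟩
  refine tendsto_of_tendsto_of_tendsto_of_le_of_le' tendsto_const_nhds ((h t ht).2 (‖a‖ + R))
    (.of_forall fun _ => zero_le) ?_
  filter_upwards [self_mem_nhdsWithin] with r hr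
  exact eLpNorm_translate_le (f := f r - f t) (fun R => ((h r hr).1 R).sub ((h t ht).1 R)) a R

theorem HasTimeDeriv.translate {I : Set ℝ} {f : ℝ → X N → ℝ} {w : X N → ℝ} {t : ℝ}
    (h : HasTimeDeriv I f w t) (hf : ∀ t ∈ I, MemL2Loc (f t)) (ht : t ∈ I) (a : X N) :
    HasTimeDeriv I (fun t z => f t (a + z)) (fun z => w (a + z)) t := by
  refine ⟨h.1.translate a, fun R => ?_⟩
  refine tendsto_of_tendsto_of_tendsto_of_le_of_le' tendsto_const_nhds (h.2 (‖a‖ + R))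
    (.of_forall fun _ => zero_le) ?_
  filter_upwards [self_mem_nhdsWithin] with r hr
  exact eLpNorm_translate_le (f := fun x => (r - t)⁻¹ * (f r x - f t x) - w x)
    (fun R => (((hf r hr.1 R).sub (hf t ht R)).const_mul _).sub (h.1 R)) a R

theorem hasTimeDeriv_timeDeriv {I : Set ℝ} {f : ℝ → X N → ℝ} {t : ℝ}
    (h : ∃ w, HasTimeDeriv I f w t) : HasTimeDeriv I f (timeDeriv I f t) t := by
  rw [timeDeriv, dif_pos h]; exact h.choose_spec

end Translation

end WaveEnergy

namespace WaveEnergy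

/-! ### The equation in similarity variables -/

section SimilarityVariables

variable {N : ℕ}

/-- The local form of the equation in similarity variables: `w` is the time primitive of `θ`
(that is, the solution of the wave equation itself), `w'` and `w''` are its first and unmixed
second weak derivatives. -/
structure SimilaritySolution (p s₀ : ℝ) (J : Set ℝ) (θ : ℝ → X N → ℝ) (θ₀₀ : X N → ℝ)
    (w : ℝ → X N → ℝ) (w' w'' : Fin N → ℝ → X N → ℝ) : Prop where
  le_of_mem : ∀ s ∈ J, s₀ ≤ s
  Icc_subset : ∀ s ∈ J, Icc s₀ s ⊆ J
  exists_gt : ∀ s ∈ J, ∃ b ∈ J, s < b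
  memL2Loc : ∀ s ∈ J, MemL2Loc (θ s)
  hasWeakPartial : ∀ s ∈ J, ∀ i, HasWeakPartial i (θ s) (weakPartial i (θ s))
  memL2Loc_partial : ∀ s ∈ J, ∀ i, MemL2Loc (weakPartial i (θ s))
  continuousOn_partial : ∀ i, ContinuousOn (fun s => cls (ballMeasure N) (weakPartial i (θ s))) J
  exists_timeDeriv : ∀ s ∈ J, ∃ k, HasTimeDeriv J θ k s
  continuousOn_timeDeriv : ContinuousOn (fun s => cls (ballMeasure N) (timeDeriv J θ s)) J
  memL2Loc_w : ∀ s ∈ J, MemL2Loc (w s)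
  hasWeakPartial_w : ∀ s ∈ J, ∀ i, HasWeakPartial i (w s) (w' i s)
  memL2Loc_w' : ∀ s ∈ J, ∀ i, MemL2Loc (w' i s)
  hasWeakPartial_w' : ∀ s ∈ J, ∀ i, HasWeakPartial i (w' i s) (w'' i s)
  memL2Loc_w'' : ∀ s ∈ J, ∀ i, MemL2Loc (w'' i s)
  continuousOn_w'' : ∀ i, ContinuousOn (fun s => cls (ballMeasure N) (w'' i s)) J
  hasDerivWithinAt_w : ∀ s ∈ J, HasDerivWithinAt (fun s => cls (ballMeasure N) (w s))
    (g₂ p s • cls (ballMeasure N) (θ s)) J s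
  equation : ∀ s ∈ J, ∀ᵐ z ∂(ballMeasure N), g p s * (θ s z * |θ s z| ^ (p - 1)) =
    g p s * (timeDeriv J θ s z + bet p * θ s z) - ∑ i, w'' i s z
  initial : w s₀ =ᵐ[volume] fun z => g p s₀ * θ₀₀ z

theorem hasDerivAt_time (T' s : ℝ) :
    HasDerivAt (fun s => T' - Real.exp (-s)) (Real.exp (-s)) s := by
  have h := ((Real.hasDerivAt_exp (-s)).comp s (hasDerivAt_neg s)).const_sub T'
  simpa using h

theorem hasDerivAt_exp_neg_rpow (β s : ℝ) :
    HasDerivAt (fun s => Real.exp (-s) ^ β) (-β * Real.exp (-s) ^ β) s := by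
  simp only [← Real.exp_mul]
  have h := (Real.hasDerivAt_exp (-s * β)).comp s ((hasDerivAt_neg s).mul_const β)
  convert! h using 1
  ring

theorem g₂_mul_exp_rpow (p s : ℝ) : g₂ p s * Real.exp (-s) ^ bet p = Real.exp (-s) := by
  rw [g₂, ← Real.exp_mul, ← Real.exp_add]; congr 1; ring

theorem g_mul_exp_rpow (p s : ℝ) : g p s * (Real.exp (-s) ^ bet p * Real.exp (-s)) = 1 := by
  rw [g, ← Real.exp_mul, ← Real.exp_add, ← Real.exp_add, Real.exp_eq_one_iff]; ring

theorem g_mul_exp_rpow_rpow {p : ℝ} (hp : 1 < p) (s : ℝ) :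
    g p s * (Real.exp (-s) ^ bet p * (Real.exp (-s) ^ bet p) ^ (p - 1)) = 1 := by
  rw [g, ← Real.exp_mul, ← Real.exp_mul, ← Real.exp_add, ← Real.exp_add, Real.exp_eq_one_iff]
  have : bet p * (p - 1) = 1 := by
    rw [bet]; field_simp [(by linarith : p - 1 ≠ 0)]
  linear_combination (-s) * this

theorem mem_sDomain_time {T T' s : ℝ} (hT' : 0 < T') (hs : s ∈ sDomain T T') :
    T' - Real.exp (-s) ∈ Ico 0 T := by
  refine ⟨?_, hs.2⟩
  have h1 : -s ≤ Real.log T' := by have := hs.1; simp only [sZero] at this; linarith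
  have h2 := (Real.exp_le_exp.2 h1).trans_eq (Real.exp_log hT')
  linarith

theorem sDomain_Icc_subset {T T' s : ℝ} (hs : s ∈ sDomain T T') :
    Icc (sZero T') s ⊆ sDomain T T' := fun r hr => by
  refine ⟨hr.1, lt_of_le_of_lt ?_ hs.2⟩
  have := Real.exp_le_exp.2 (neg_le_neg hr.2)
  linarith

theorem isOpen_time_lt (T T' : ℝ) : IsOpen {s : ℝ | T' - Real.exp (-s) < T} :=
  isOpen_lt (by fun_prop) continuous_const

theorem sDomain_exists_gt {T T' s : ℝ} (hs : s ∈ sDomain T T') : ∃ b ∈ sDomain T T', s < b := by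
  obtain ⟨b, hb, hb'⟩ := ((isOpen_time_lt T T').mem_nhds hs.2 |> fun h =>
    (mem_nhdsGT_iff_exists_Ioc_subset.1 (mem_nhdsWithin_of_mem_nhds h)))
  exact ⟨b, ⟨hs.1.trans (le_of_lt hb), hb' ⟨hb, le_rfl⟩⟩, hb⟩

theorem uniqueDiffOn_sDomain (T T' : ℝ) : UniqueDiffOn ℝ (sDomain T T') := by
  have : sDomain T T' = Ici (sZero T') ∩ {s : ℝ | T' - Real.exp (-s) < T} := rfl
  rw [this]
  exact (uniqueDiffOn_Ici _).inter (isOpen_time_lt T T')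

/-- The chain rule along `t = T' - e^{-s}`, with `dt/ds = e^{-s}`. The powers of `e^{-s}` balance
because `β(p - 1) = 1`. -/
theorem IsStrongSolution.similaritySolution {p T : ℝ} {u₀ u₁ : X N → ℝ} {u : ℝ → X N → ℝ}
    (hp : 1 < p) (hu : IsStrongSolution p T u₀ u₁ u) {T' : ℝ} (hT' : 0 < T') (a : X N) :
    SimilaritySolution p (sZero T') (sDomain T T') (theta p T T' a u) (thetaInit p T' a u₀)
      (fun s z => u (T' - Real.exp (-s)) (a + z))
      (fun i s z => weakPartial i (u (T' - Real.exp (-s))) (a + z))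
      (fun i s z => weakPartial i (weakPartial i (u (T' - Real.exp (-s)))) (a + z)) := by
  set I : Set ℝ := Ico 0 T with hI
  set J : Set ℝ := sDomain T T' with hJ
  set v : ℝ → X N → ℝ := timeDeriv I u with hv
  set v' : ℝ → X N → ℝ := timeDeriv I v with hv'
  set θ : ℝ → X N → ℝ := theta p T T' a u with hθ
  set tm : ℝ → ℝ := fun s => T' - Real.exp (-s) with htm
  have htmI : MapsTo tm J I := fun s hs => mem_sDomain_time hT' hs
  have htmd : ∀ s, HasDerivWithinAt tm (Real.exp (-s)) J s :=
    fun s => (hasDerivAt_time T' s).hasDerivWithinAt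
  have htmc : ContinuousOn tm J := fun s _ => (htmd s).continuousWithinAt
  have cu := hu.cont_H2
  have cv := hu.deriv_cont_H1
  have cv' := hu.deriv_two_cont
  rw [← hI] at cu cv cv'
  rw [← hv] at cv cv'
  rw [← hv'] at cv'
  rw [ContinuousIntoHLoc] at cu cv
  have cu1 := fun i => (cu.2 i).2
  simp only [ContinuousIntoHLoc.eq_2] at cu1
  have cu2 : ∀ i, ContinuousIntoHLoc 0 I fun t => weakPartial i (weakPartial i (u t)) :=
    fun i => ((cu1 i).2 i).2
  have mu : ∀ t ∈ I, MemL2Loc (u t) := (continuousIntoHLoc_zero_iff.1 cu.1).1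
  have mui : ∀ i, ∀ t ∈ I, MemL2Loc (weakPartial i (u t)) :=
    fun i => (continuousIntoHLoc_zero_iff.1 (cu1 i).1).1
  have muii : ∀ i, ∀ t ∈ I, MemL2Loc (weakPartial i (weakPartial i (u t))) :=
    fun i => (continuousIntoHLoc_zero_iff.1 (cu2 i)).1
  have mv : ∀ t ∈ I, MemL2Loc (v t) := (continuousIntoHLoc_zero_iff.1 cv.1).1
  have mvi : ∀ i, ∀ t ∈ I, MemL2Loc (weakPartial i (v t)) :=
    fun i => (continuousIntoHLoc_zero_iff.1 (cv.2 i).2).1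
  have mv' : ∀ t ∈ I, MemL2Loc (v' t) := (continuousIntoHLoc_zero_iff.1 cv').1
  have wv : ∀ t ∈ I, ∀ i, HasWeakPartial i (v t) (weakPartial i (v t)) :=
    fun t ht i => hasWeakPartial_weakPartial ((cv.2 i).1 t ht)
  have hθe : ∀ s z, θ s z = Real.exp (-s) ^ bet p * v (tm s) (a + z) := fun s z => rfl
  have mθ : ∀ s ∈ J, MemL2Loc (θ s) := fun s hs =>
    ((mv _ (htmI hs)).translate a).const_mul _
  have wθ : ∀ s ∈ J, ∀ i, HasWeakPartial i (θ s)
      (fun z => Real.exp (-s) ^ bet p * weakPartial i (v (tm s)) (a + z)) := fun s hs i =>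
    ((wv _ (htmI hs) i).translate a).const_mul _
  have aeθi : ∀ s ∈ J, ∀ i, weakPartial i (θ s) =ᵐ[volume]
      (fun z => Real.exp (-s) ^ bet p * weakPartial i (v (tm s)) (a + z)) := fun s hs i =>
    (wθ s hs i).weakPartial_ae_eq
  have mθi : ∀ s ∈ J, ∀ i, MemL2Loc (weakPartial i (θ s)) := fun s hs i =>
    (((mvi i _ (htmI hs)).translate a).const_mul _).congr (aeθi s hs i).symm
  -- the time derivative of `θ`
  set θ' : ℝ → X N → ℝ := fun s z => -bet p * Real.exp (-s) ^ bet p * v (tm s) (a + z) +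
    Real.exp (-s) ^ bet p * Real.exp (-s) * v' (tm s) (a + z) with hθ'
  have clsθ : ∀ R, ∀ s ∈ J, cls (ballMeas N R) (θ s) =
      Real.exp (-s) ^ bet p • cls (ballMeas N R) (fun z => v (tm s) (a + z)) := fun R s hs =>
    cls_smul _ (((mv _ (htmI hs)).translate a) R)
  have dV : ∀ s ∈ J, ∀ R, HasDerivWithinAt (fun t => cls (ballMeas N R) (fun z => v t (a + z)))
      (cls (ballMeas N R) (fun z => v' (tm s) (a + z))) I (tm s) := fun s hs =>
    ((hasTimeDeriv_iff (fun t ht => (mv t ht).translate a) (htmI hs)).1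
      ((hasTimeDeriv_timeDeriv (hu.hasDeriv_two _ (htmI hs))).translate mv (htmI hs) a)).2
  have dU : ∀ s ∈ J, ∀ R, HasDerivWithinAt (fun t => cls (ballMeas N R) (fun z => u t (a + z)))
      (cls (ballMeas N R) (fun z => v (tm s) (a + z))) I (tm s) := fun s hs =>
    ((hasTimeDeriv_iff (fun t ht => (mu t ht).translate a) (htmI hs)).1
      ((hasTimeDeriv_timeDeriv (hu.hasDeriv _ (htmI hs))).translate mu (htmI hs) a)).2
  have mθ' : ∀ s ∈ J, MemL2Loc (θ' s) := fun s hs R =>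
    ((((mv _ (htmI hs)).translate a).const_mul _) R).add
      ((((mv' _ (htmI hs)).translate a).const_mul _) R)
  have clsθ' : ∀ R, ∀ s ∈ J, cls (ballMeas N R) (θ' s) =
      (-bet p * Real.exp (-s) ^ bet p) • cls (ballMeas N R) (fun z => v (tm s) (a + z)) +
      (Real.exp (-s) ^ bet p * Real.exp (-s)) •
        cls (ballMeas N R) (fun z => v' (tm s) (a + z)) := fun R s hs => by
    have m1 := ((mv _ (htmI hs)).translate a) R
    have m2 := ((mv' _ (htmI hs)).translate a) R
    rw [hθ', cls_add (m1.const_mul _) (m2.const_mul _), cls_smul _ m1, cls_smul _ m2]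
  have dθ : ∀ s ∈ J, ∀ R, HasDerivWithinAt (fun s => cls (ballMeas N R) (θ s))
      (cls (ballMeas N R) (θ' s)) J s := fun s hs R => by
    have h1 := (dV s hs R).scomp s (htmd s) htmI
    have h2 := ((hasDerivAt_exp_neg_rpow (bet p) s).hasDerivWithinAt (s := J)).smul h1
    refine (h2.congr_of_mem (fun r hr => clsθ R r hr) hs).congr_deriv ?_
    rw [clsθ' R s hs, smul_smul, add_comm]
    rfl
  have tdθ : ∀ s ∈ J, HasTimeDeriv J θ (θ' s) s := fun s hs =>
    (hasTimeDeriv_iff mθ hs).2 ⟨mθ' s hs, dθ s hs⟩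
  have tdθ2 : ∀ s ∈ J, HasTimeDeriv J θ (timeDeriv J θ s) s := fun s hs =>
    hasTimeDeriv_timeDeriv ⟨_, tdθ s hs⟩
  -- The chosen time derivative agrees almost everywhere on the ball with the explicit `θ'`, by
  -- uniqueness of derivatives within `J`, including at its left end point.
  have clstd : ∀ s ∈ J, cls (ballMeas N 1) (timeDeriv J θ s) = cls (ballMeas N 1) (θ' s) :=
    fun s hs => (uniqueDiffOn_sDomain T T' s hs).eq_deriv _
      (((hasTimeDeriv_iff mθ hs).1 (tdθ2 s hs)).2 1) (dθ s hs 1)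
  have expc : Continuous fun s : ℝ => Real.exp (-s) ^ bet p :=
    continuous_iff_continuousAt.2 fun s => (hasDerivAt_exp_neg_rpow (bet p) s).continuousAt
  refine
    { le_of_mem := fun s hs => hs.1
      Icc_subset := fun s hs => sDomain_Icc_subset hs
      exists_gt := fun s hs => sDomain_exists_gt hs
      memL2Loc := mθ
      hasWeakPartial := fun s hs i => hasWeakPartial_weakPartial ⟨_, wθ s hs i⟩
      memL2Loc_partial := mθi
      continuousOn_partial := fun i => ?_
      exists_timeDeriv := fun s hs => ⟨_, tdθ s hs⟩
      continuousOn_timeDeriv := ?_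
      memL2Loc_w := fun s hs => (mu _ (htmI hs)).translate a
      hasWeakPartial_w := fun s hs i =>
        (hasWeakPartial_weakPartial ((cu.2 i).1 _ (htmI hs))).translate a
      memL2Loc_w' := fun s hs i => (mui i _ (htmI hs)).translate a
      hasWeakPartial_w' := fun s hs i =>
        (hasWeakPartial_weakPartial (((cu1 i).2 i).1 _ (htmI hs))).translate a
      memL2Loc_w'' := fun s hs i => (muii i _ (htmI hs)).translate a
      continuousOn_w'' := fun i =>
        ((continuousIntoHLoc_zero_iff.1 ((cu2 i).translate a)).2 1).comp htmc htmI
      hasDerivWithinAt_w := fun s hs => ?_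
      equation := fun s hs => ?_
      initial := ?_ }
  · have h1 := expc.continuousOn.smul
      (((continuousIntoHLoc_zero_iff.1 ((cv.2 i).2.translate a)).2 1).comp htmc htmI)
    refine h1.congr fun s hs => ?_
    exact (cls_congr (ae_restrict_of_ae (aeθi s hs i))).trans
      (cls_smul _ (((mvi i _ (htmI hs)).translate a) 1))
  · have c1 := ((continuousIntoHLoc_zero_iff.1 (cv.1.translate a)).2 1).comp htmc htmI
    have c2 := ((continuousIntoHLoc_zero_iff.1 (cv'.translate a)).2 1).comp htmc htmI
    have expc' : Continuous fun s : ℝ => -bet p * Real.exp (-s) ^ bet p := continuous_const.mul expc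
    have h1 := (expc'.continuousOn.smul c1).add
      ((expc.mul (Real.continuous_exp.comp continuous_neg)).continuousOn.smul c2)
    exact h1.congr fun s hs => (clstd s hs).trans (clsθ' 1 s hs)
  · have h1 := (dU s hs 1).scomp s (htmd s) htmI
    refine h1.congr_deriv ?_
    have h2 := clsθ 1 s hs
    have h3 : g₂ p s • cls (ballMeas N 1) (θ s) =
        Real.exp (-s) • cls (ballMeas N 1) (fun z => v (tm s) (a + z)) := by
      rw [h2, smul_smul, g₂_mul_exp_rpow]
    exact h3.symm
  · have e1 := (measurePreserving_translate a).quasiMeasurePreserving.ae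
      (hu.equation _ (htmI hs))
    have e2 := (cls_eq_iff ((tdθ2 s hs).1 1) (mθ' s hs 1)).1 (clstd s hs)
    filter_upwards [ae_restrict_of_ae (s := B N) e1, e2] with z h1 h2
    rw [h2, hθe, hθ']
    have h1' : v' (tm s) (a + z) - ∑ i, weakPartial i (weakPartial i (u (tm s))) (a + z) =
        v (tm s) (a + z) * |v (tm s) (a + z)| ^ (p - 1) := h1
    have hc : 0 ≤ Real.exp (-s) ^ bet p := Real.rpow_nonneg (Real.exp_pos _).le _
    rw [abs_mul, abs_of_nonneg hc, Real.mul_rpow hc (abs_nonneg _)]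
    linear_combination (v (tm s) (a + z) * |v (tm s) (a + z)| ^ (p - 1)) *
      g_mul_exp_rpow_rpow hp s - h1' - v' (tm s) (a + z) * g_mul_exp_rpow p s
  · have h0 : T' - Real.exp (-sZero T') = 0 := by simp [sZero, Real.exp_log hT']
    have e1 := (measurePreserving_translate a).quasiMeasurePreserving.ae hu.initial_value
    filter_upwards [e1] with z hz
    have h1 : g p (sZero T') * T' ^ (bet p + 1) = 1 := by
      rw [g, sZero, Real.rpow_def_of_pos hT', ← Real.exp_add, Real.exp_eq_one_iff]
      ring
    rw [h0, hz, thetaInit, ← mul_assoc, h1, one_mul]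

end SimilarityVariables

end WaveEnergy

namespace WaveEnergy

/-! ### Convergent integrals over the ball and convexity of the power -/

section BallIntegrals

variable {N : ℕ}

/-- The integral of `f` over the unit ball converges and equals `c`. -/
def HasBallIntegral (f : X N → ℝ) (c : ℝ) : Prop :=
  IntegrableOn f (B N) ∧ ∫ z in B N, f z = c

namespace HasBallIntegral

variable {f h : X N → ℝ} {c d : ℝ}

theorem add (hf : HasBallIntegral f c) (hh : HasBallIntegral h d) :
    HasBallIntegral (fun z => f z + h z) (c + d) :=
  ⟨hf.1.add hh.1, by rw [integral_add hf.1 hh.1, hf.2, hh.2]⟩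

theorem sub (hf : HasBallIntegral f c) (hh : HasBallIntegral h d) :
    HasBallIntegral (fun z => f z - h z) (c - d) :=
  ⟨hf.1.sub hh.1, by rw [integral_sub hf.1 hh.1, hf.2, hh.2]⟩

theorem const_mul (hf : HasBallIntegral f c) (k : ℝ) :
    HasBallIntegral (fun z => k * f z) (k * c) :=
  ⟨hf.1.const_mul k, by rw [integral_const_mul, hf.2]⟩

theorem sum {ι : Type*} [Fintype ι] {f : ι → X N → ℝ} {c : ι → ℝ}
    (hf : ∀ i, HasBallIntegral (f i) (c i)) :
    HasBallIntegral (fun z => ∑ i, f i z) (∑ i, c i) :=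
  ⟨integrable_finsetSum _ fun i _ => (hf i).1, by
    rw [integral_finsetSum _ fun i _ => (hf i).1]
    exact Finset.sum_congr rfl fun i _ => (hf i).2⟩

theorem congr (hf : HasBallIntegral f c) (e : ∀ z ∈ B N, h z = f z) (e' : d = c) :
    HasBallIntegral h d := by
  have hm : MeasurableSet (B N) := measurableSet_closedBall
  refine ⟨hf.1.congr_fun (fun z hz => (e z hz).symm) hm, ?_⟩
  rw [setIntegral_congr_fun hm e, hf.2, e']

theorem mono (hf : HasBallIntegral f c) (hh : HasBallIntegral h d)
    (e : ∀ z ∈ B N, f z ≤ h z) : c ≤ d := by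
  rw [← hf.2, ← hh.2]
  exact setIntegral_mono_on hf.1 hh.1 measurableSet_closedBall e

end HasBallIntegral

variable {f h : X N → ℝ}

theorem MemL2Loc.memLp_ball (hf : MemL2Loc f) : MemLp f 2 (ballMeasure N) := hf 1

theorem hasBallIntegral_rho {γ : ℝ} (hγ : 0 ≤ γ) (hf : MemLp f 2 (ballMeasure N))
    (hh : MemLp h 2 (ballMeasure N)) :
    HasBallIntegral (fun z => rho z ^ γ * f z * h z)
      (inner ℝ (rhoMul N γ (cls (ballMeasure N) f)) (cls (ballMeasure N) h)) :=
  ⟨integrable_mul_mul (memLp_rho hγ) hf hh,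
    (inner_mulC (memLp_rho hγ) hf hh).symm⟩

theorem hasBallIntegral_coord {γ : ℝ} (hγ : 0 ≤ γ) (i : Fin N) (hf : MemLp f 2 (ballMeasure N))
    (hh : MemLp h 2 (ballMeasure N)) : HasBallIntegral (fun z => z i * rho z ^ γ * f z * h z)
      (inner ℝ (coordMul γ i (cls (ballMeasure N) f)) (cls (ballMeasure N) h)) :=
  ⟨integrable_mul_mul (memLp_coord hγ i) hf hh,
    (inner_mulC (memLp_coord hγ i) hf hh).symm⟩

theorem hasBallIntegral_div {γ : ℝ} (hγ : 1 ≤ γ) (hf : MemLp f 2 (ballMeasure N))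
    (hh : MemLp h 2 (ballMeasure N)) :
    HasBallIntegral (fun z => (N * rho z - 2 * γ * ‖z‖ ^ 2) * rho z ^ (γ - 1) * f z * h z)
      (inner ℝ (divMul N γ (cls (ballMeasure N) f)) (cls (ballMeasure N) h)) :=
  ⟨integrable_mul_mul (memLp_div hγ) hf hh,
    (inner_mulC (memLp_div hγ) hf hh).symm⟩

theorem norm_sq_weakGrad (f : X N → ℝ) (z : X N) :
    ‖weakGrad f z‖ ^ 2 = ∑ i, weakPartial i f z ^ 2 := by
  rw [EuclideanSpace.norm_sq_eq]; simp [weakGrad]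

theorem radial_eq_sum (f : X N → ℝ) (z : X N) : radial f z = ∑ i, z i * weakPartial i f z := by
  simp [radial, weakGrad, PiLp.inner_apply, mul_comm]

/-- The graph of the convex function `|x|^q` lies above its tangent at `x`. -/
theorem rpow_abs_tangent {q : ℝ} (hq : 1 < q) (x y : ℝ) :
    q * (x * |x| ^ (q - 2)) * (y - x) ≤ |y| ^ q - |x| ^ q := by
  have hconv : ConvexOn ℝ univ fun x : ℝ => |x| ^ q := by
    have h1 : ConvexOn ℝ univ fun x : ℝ => ‖x‖ := convexOn_univ_norm
    have h2 : ConvexOn ℝ (Ici 0) fun x : ℝ => x ^ q := convexOn_rpow hq.le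
    refine ⟨convex_univ, fun a _ b _ s t hs ht hst => ?_⟩
    have h3 : |s • a + t • b| ≤ s • |a| + t • |b| := h1.2 trivial trivial hs ht hst
    exact (Real.rpow_le_rpow (abs_nonneg _) h3 (by linarith)).trans
      (h2.2 (abs_nonneg a) (abs_nonneg b) hs ht hst)
  have hd := hasDerivAt_abs_rpow x hq
  have hd' : q * |x| ^ (q - 2) * x = q * (x * |x| ^ (q - 2)) := by ring
  rw [hd'] at hd
  rcases lt_trichotomy x y with hxy | rfl | hxy
  · have h := hconv.le_slope_of_hasDerivAt trivial trivial hxy hd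
    rw [slope_def_field, le_div_iff₀ (by linarith)] at h
    exact h
  · simp
  · have h := hconv.slope_le_of_hasDerivAt trivial trivial hxy hd
    rw [slope_def_field, div_le_iff₀ (by linarith)] at h
    linarith

theorem abs_rpow_add_one {p : ℝ} (hp : 1 < p) (x : ℝ) :
    |x| ^ (p + 1) = x * |x| ^ (p - 1) * x := by
  rw [show p + 1 = (p - 1) + 2 by ring,
    Real.rpow_add_of_nonneg (abs_nonneg x) (by linarith) (by norm_num), Real.rpow_two, sq_abs]
  ring

end BallIntegrals

/-! ### Time regularity of the gradient of `w` and of the nonlinearity -/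

namespace SimilaritySolution

variable {N : ℕ} {p s₀ : ℝ} {J : Set ℝ} {θ : ℝ → X N → ℝ} {θ₀₀ : X N → ℝ}
  {w : ℝ → X N → ℝ} {w' w'' : Fin N → ℝ → X N → ℝ}

/-- The nonlinearity `θ|θ|^(p-1)`. -/
noncomputable def nonlin (p : ℝ) (θ : ℝ → X N → ℝ) (s : ℝ) (z : X N) : ℝ :=
  θ s z * |θ s z| ^ (p - 1)

theorem g_pos (p s : ℝ) : 0 < g p s := Real.exp_pos _

theorem g₂_pos (p s : ℝ) : 0 < g₂ p s := Real.exp_pos _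

theorem hasDerivAt_g (p s : ℝ) : HasDerivAt (g p) ((bet p + 1) * g p s) s := by
  have h := (Real.hasDerivAt_exp ((bet p + 1) * s)).comp s
    ((hasDerivAt_id s).const_mul (bet p + 1))
  convert! h using 1
  simp [g, mul_comm]

theorem continuous_g (p : ℝ) : Continuous (g p) := by unfold g; fun_prop

theorem continuous_g₂ (p : ℝ) : Continuous (g₂ p) := by unfold g₂; fun_prop

theorem hasDerivWithinAt_theta (hS : SimilaritySolution p s₀ J θ θ₀₀ w w' w'') {s : ℝ}
    (hs : s ∈ J) : HasDerivWithinAt (fun s => cls (ballMeasure N) (θ s))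
      (cls (ballMeasure N) (timeDeriv J θ s)) J s :=
  ((hasTimeDeriv_iff hS.memL2Loc hs).1 (hasTimeDeriv_timeDeriv (hS.exists_timeDeriv s hs))).2 1

theorem memL2Loc_timeDeriv (hS : SimilaritySolution p s₀ J θ θ₀₀ w w' w'') {s : ℝ}
    (hs : s ∈ J) : MemL2Loc (timeDeriv J θ s) :=
  (hasTimeDeriv_timeDeriv (hS.exists_timeDeriv s hs)).1

theorem continuousOn_theta (hS : SimilaritySolution p s₀ J θ θ₀₀ w w' w'') :
    ContinuousOn (fun s => cls (ballMeasure N) (θ s)) J :=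
  fun _ hs => (hS.hasDerivWithinAt_theta hs).continuousWithinAt

/-- The sphere is a null set. Passing to the open ball permits test functions with compact support
inside it. -/
theorem ballMeasure_eq : ballMeasure N = volume.restrict (Metric.ball 0 1) := by
  refine Measure.restrict_congr_set ?_
  refine Filter.EventuallyEq.symm (ae_eq_of_subset_of_measure_ge Metric.ball_subset_closedBall
    ?_ measurableSet_ball.nullMeasurableSet ?_)
  · rw [B, Measure.addHaar_unitClosedBall_eq_addHaar_unitBall]
  · exact measure_closedBall_lt_top.ne

theorem inner_cls_test {k φ : X N → ℝ} (hk : MemL2Loc k) (hφ : Continuous φ)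
    (hc : HasCompactSupport φ) (hs : tsupport φ ⊆ Metric.ball 0 1) :
    inner ℝ (cls (ballMeasure N) k) (cls (ballMeasure N) φ) = ∫ z, k z * φ z := by
  rw [inner_cls hk.memLp_ball (memLp_test hφ hc 2)]
  refine setIntegral_eq_integral_of_forall_compl_eq_zero fun z hz => ?_
  have : φ z = 0 := image_eq_zero_of_notMem_tsupport fun h =>
    hz (Metric.ball_subset_closedBall (hs h))
  simp [this]

/-- Space and time derivatives commute in the weak sense: against a test function, `∂_i` moves onto
the test function and `w` is differentiated in time. Continuity of `∂_i θ` in L² makes this a strong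
derivative. -/
theorem hasDerivWithinAt_w' (hS : SimilaritySolution p s₀ J θ θ₀₀ w w' w'') (i : Fin N) {b : ℝ}
    (hb : b ∈ J) (hb' : s₀ < b) {s : ℝ} (hs : s ∈ Icc s₀ b) :
    HasDerivWithinAt (fun s => cls (ballMeasure N) (w' i s))
      (g₂ p s • cls (ballMeasure N) (weakPartial i (θ s))) (Icc s₀ b) s := by
  have hsub := hS.Icc_subset b hb
  have hsep : ∀ x : Lp ℝ 2 (ballMeasure N),
      (∀ d ∈ testClasses (Metric.ball 0 1) (ballMeasure N), inner ℝ x d = 0) → x = 0 := by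
    rw [ballMeasure_eq]
    exact eq_zero_of_testClasses Metric.isOpen_ball
  refine hasDerivWithinAt_of_inner hsep hb'
    (f' := fun s => g₂ p s • cls (ballMeasure N) (weakPartial i (θ s)))
    ((continuous_g₂ p).continuousOn.smul ((hS.continuousOn_partial i).mono hsub)) ?_ s hs
  rintro _ ⟨φ, h1, h2, h3, rfl⟩ r hr
  have hrJ := hsub hr
  set φ' : X N → ℝ := fun z => fderiv ℝ φ z (EuclideanSpace.single i 1) with hφ'
  have c1 : Continuous φ' := (h1.continuous_fderiv (by simp)).clm_apply continuous_const
  have c2 : HasCompactSupport φ' := h2.fderiv_apply ℝ _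
  have c3 : tsupport φ' ⊆ Metric.ball 0 1 := (tsupport_fderiv_apply_subset ℝ _).trans h3
  have e1 : ∀ τ ∈ J, inner ℝ (cls (ballMeasure N) (w' i τ)) (cls (ballMeasure N) φ) =
      -inner ℝ (cls (ballMeasure N) (w τ)) (cls (ballMeasure N) φ') := fun τ hτ => by
    rw [inner_cls_test (hS.memL2Loc_w' τ hτ i) h1.continuous h2 h3,
      inner_cls_test (hS.memL2Loc_w τ hτ) c1 c2 c3,
      (hS.hasWeakPartial_w τ hτ i).2.2 φ h1 h2, neg_neg]
  have e2 : inner ℝ (cls (ballMeasure N) (weakPartial i (θ r))) (cls (ballMeasure N) φ) =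
      -inner ℝ (cls (ballMeasure N) (θ r)) (cls (ballMeasure N) φ') := by
    rw [inner_cls_test (hS.memL2Loc_partial r hrJ i) h1.continuous h2 h3,
      inner_cls_test (hS.memL2Loc r hrJ) c1 c2 c3,
      (hS.hasWeakPartial r hrJ i).2.2 φ h1 h2, neg_neg]
  have h := (((hS.hasDerivWithinAt_w r hrJ).mono hsub).inner ℝ
    (hasDerivWithinAt_const r (Icc s₀ b) (cls (ballMeasure N) φ'))).fun_neg
  refine (h.congr_of_mem (fun τ hτ => e1 τ (hsub hτ)) hr).congr_deriv ?_
  simp [inner_smul_left, e2]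

/-- Solving the equation for the nonlinearity expresses it through terms that are square integrable
and continuous in time, with no growth condition on `p`. -/
theorem ae_nonlin_eq (hS : SimilaritySolution p s₀ J θ θ₀₀ w w' w'') {s : ℝ} (hs : s ∈ J) :
    nonlin p θ s =ᵐ[ballMeasure N] fun z => timeDeriv J θ s z + bet p * θ s z -
      (g p s)⁻¹ * ∑ i, w'' i s z := by
  filter_upwards [hS.equation s hs] with z hz
  have := (g_pos p s).ne'
  rw [nonlin]
  field_simp
  linarith

theorem memLp_nonlin (hS : SimilaritySolution p s₀ J θ θ₀₀ w w' w'') {s : ℝ} (hs : s ∈ J) :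
    MemLp (nonlin p θ s) 2 (ballMeasure N) :=
  (memLp_congr_ae (hS.ae_nonlin_eq hs)).2 (((hS.memL2Loc_timeDeriv hs 1).add
    ((hS.memL2Loc s hs 1).const_mul _)).sub
      ((memLp_finsetSum _ fun i _ => hS.memL2Loc_w'' s hs i 1).const_mul _))

theorem cls_nonlin (hS : SimilaritySolution p s₀ J θ θ₀₀ w w' w'') {s : ℝ} (hs : s ∈ J) :
    cls (ballMeasure N) (nonlin p θ s) = cls (ballMeasure N) (timeDeriv J θ s) +
      bet p • cls (ballMeasure N) (θ s) -
      (g p s)⁻¹ • ∑ i, cls (ballMeasure N) (w'' i s) := by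
  have m1 := (hS.memL2Loc_timeDeriv hs).memLp_ball
  have m2 := (hS.memL2Loc s hs).memLp_ball
  have m3 : ∀ i ∈ Finset.univ, MemLp (w'' i s) 2 (ballMeasure N) :=
    fun i _ => hS.memL2Loc_w'' s hs i 1
  have m4 := memLp_finsetSum Finset.univ m3
  have m5 : MemLp (fun z => timeDeriv J θ s z + bet p * θ s z) 2 (ballMeasure N) :=
    m1.add (m2.const_mul _)
  rw [cls_congr (hS.ae_nonlin_eq hs), cls_sub m5 (m4.const_mul _),
    cls_add m1 (m2.const_mul _), cls_smul _ m2, cls_smul _ m4, cls_sum _ m3]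

theorem continuousOn_nonlin (hS : SimilaritySolution p s₀ J θ θ₀₀ w w' w'') :
    ContinuousOn (fun s => cls (ballMeasure N) (nonlin p θ s)) J := by
  have c1 : ContinuousOn (fun s => (g p s)⁻¹) J :=
    ((continuous_g p).inv₀ fun s => (g_pos p s).ne').continuousOn
  have c2 : ContinuousOn (fun s => ∑ i, cls (ballMeasure N) (w'' i s)) J :=
    continuousOn_finsetSum _ fun i _ => hS.continuousOn_w'' i
  have c3 : ContinuousOn (fun s => bet p • cls (ballMeasure N) (θ s)) J :=
    (continuousOn_const (c := bet p)).smul hS.continuousOn_theta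
  exact ((hS.continuousOn_timeDeriv.add c3).sub (c1.smul c2)).congr fun s hs => hS.cls_nonlin hs

theorem hasBallIntegral_nonlin (hS : SimilaritySolution p s₀ J θ θ₀₀ w w' w'') {α : ℝ}
    (hα : 0 ≤ α) {r s : ℝ} (hr : r ∈ J) (hs : s ∈ J) :
    HasBallIntegral (fun z => rho z ^ α * nonlin p θ r z * θ s z)
      (inner ℝ (rhoMul N α (cls (ballMeasure N) (nonlin p θ r)))
        (cls (ballMeasure N) (θ s))) :=
  ⟨integrable_mul_mul (memLp_rho hα) (hS.memLp_nonlin hr) (hS.memL2Loc s hs 1),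
    (inner_mulC (memLp_rho hα) (hS.memLp_nonlin hr) (hS.memL2Loc s hs 1)).symm⟩

/-- The tangent inequality for `|x|^{p+1}`, integrated against the nonnegative weight `ρ^α`. -/
theorem nonlin_subgradient (hp : 1 < p) (hS : SimilaritySolution p s₀ J θ θ₀₀ w w' w'') {α : ℝ}
    (hα : 0 ≤ α) {r r' : ℝ} (hr : r ∈ J) (hr' : r' ∈ J) :
    (p + 1) * inner ℝ (rhoMul N α (cls (ballMeasure N) (nonlin p θ r)))
      (cls (ballMeasure N) (θ r') - cls (ballMeasure N) (θ r)) ≤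
    inner ℝ (rhoMul N α (cls (ballMeasure N) (nonlin p θ r'))) (cls (ballMeasure N) (θ r')) -
    inner ℝ (rhoMul N α (cls (ballMeasure N) (nonlin p θ r))) (cls (ballMeasure N) (θ r)) := by
  rw [inner_sub_right]
  have i1 := hS.hasBallIntegral_nonlin hα hr hr'
  have i2 := hS.hasBallIntegral_nonlin hα hr hr
  have i3 := hS.hasBallIntegral_nonlin hα hr' hr'
  refine ((i1.sub i2).const_mul (p + 1)).mono (i3.sub i2) fun z hz => ?_
  have h1 := rpow_abs_tangent (q := p + 1) (by linarith) (θ r z) (θ r' z)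
  rw [abs_rpow_add_one hp, abs_rpow_add_one hp, show p + 1 - 2 = p - 1 by ring] at h1
  have h2 := mul_le_mul_of_nonneg_left h1 (Real.rpow_nonneg (rho_nonneg hz) α)
  simp only [nonlin]
  linarith

end SimilaritySolution

end WaveEnergy

namespace WaveEnergy

/-! ### The integrals of the energy and of the dissipation as quadratic forms -/

namespace SimilaritySolution

variable {N : ℕ} {p s₀ : ℝ} {J : Set ℝ} {θ : ℝ → X N → ℝ} {θ₀₀ : X N → ℝ}
  {w : ℝ → X N → ℝ} {w' w'' : Fin N → ℝ → X N → ℝ}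

/-- The weighted square integral `∫ ρ^γ θ²`. -/
noncomputable def massForm (γ : ℝ) (f : X N → ℝ) : ℝ :=
  inner ℝ (rhoMul N γ (cls (ballMeasure N) f)) (cls (ballMeasure N) f)

/-- The weighted integral `∫ ρ^α |θ|^(p+1)`. -/
noncomputable def powerForm (p α : ℝ) (θ : ℝ → X N → ℝ) (s : ℝ) : ℝ :=
  inner ℝ (rhoMul N α (cls (ballMeasure N) (nonlin p θ s))) (cls (ballMeasure N) (θ s))

/-- The weighted Dirichlet integral `∫ ρ^α |∇f|²`. -/
noncomputable def dirichletForm (α : ℝ) (f : X N → ℝ) : ℝ :=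
  ∑ i, inner ℝ (rhoMul N α (cls (ballMeasure N) (weakPartial i f)))
    (cls (ballMeasure N) (weakPartial i f))

/-- The weighted integral `∫ div (ρ^γ z) f²`. -/
noncomputable def divForm (γ : ℝ) (f : X N → ℝ) : ℝ :=
  inner ℝ (divMul N γ (cls (ballMeasure N) f)) (cls (ballMeasure N) f)

theorem memLp_theta (hS : SimilaritySolution p s₀ J θ θ₀₀ w w' w'') {s : ℝ} (hs : s ∈ J) :
    MemLp (θ s) 2 (ballMeasure N) := (hS.memL2Loc s hs).memLp_ball

theorem memLp_partial (hS : SimilaritySolution p s₀ J θ θ₀₀ w w' w'') {s : ℝ} (hs : s ∈ J)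
    (i : Fin N) : MemLp (weakPartial i (θ s)) 2 (ballMeasure N) :=
  (hS.memL2Loc_partial s hs i).memLp_ball

theorem hasBallIntegral_e₁ (hS : SimilaritySolution p s₀ J θ θ₀₀ w w' w'') {α s : ℝ}
    (hα : 2 < α) (hs : s ∈ J) : HasBallIntegral (e₁ p α θ s) (g p s *
      massForm α (θ s)) :=
  ((hasBallIntegral_rho (by linarith) (hS.memLp_theta hs) (hS.memLp_theta hs)).const_mul
    (g p s)).congr (fun z _ => by simp only [e₁]; ring) rfl

theorem hasBallIntegral_e₂ (hp : 1 < p) (hS : SimilaritySolution p s₀ J θ θ₀₀ w w' w'') {α s : ℝ}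
    (hα : 2 < α) (hs : s ∈ J) : HasBallIntegral (e₂ p α θ s) (g p s *
      powerForm p α θ s) :=
  ((hS.hasBallIntegral_nonlin (by linarith) hs hs).const_mul (g p s)).congr
    (fun z _ => by simp only [e₂, nonlin, abs_rpow_add_one hp]; ring) rfl

theorem inner_weakGrad (f h : X N → ℝ) (z : X N) :
    inner ℝ (weakGrad f z) (weakGrad h z) = ∑ i, weakPartial i f z * weakPartial i h z := by
  simp [weakGrad, PiLp.inner_apply, mul_comm]

/-- Expanding the square cancels `|∇θ(s)|²`; the cross term is linear in `∇θ(τ)`, hence integrable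
in time to `∇w`. -/
theorem hasBallIntegral_e₃ (hS : SimilaritySolution p s₀ J θ θ₀₀ w w' w'') {α s τ : ℝ}
    (hα : 2 < α) (hs : s ∈ J) (hτ : τ ∈ J) : HasBallIntegral (e₃ p α θ s τ)
      (16 * (g₂ p τ * dirichletForm α (θ τ)) -
      8 * (∑ i, g₂ p τ * inner ℝ (rhoMul N α (cls (ballMeasure N) (weakPartial i (θ τ))))
        (cls (ballMeasure N) (weakPartial i (θ s))))) := by
  have h0 : (0 : ℝ) ≤ α := by linarith
  refine ((((HasBallIntegral.sum fun i => hasBallIntegral_rho h0 (hS.memLp_partial hτ i)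
    (hS.memLp_partial hτ i)).const_mul (g₂ p τ)).const_mul 16).sub
    ((HasBallIntegral.sum fun i => (hasBallIntegral_rho h0 (hS.memLp_partial hτ i)
      (hS.memLp_partial hs i)).const_mul (g₂ p τ)).const_mul 8)).congr (fun z _ => ?_) rfl
  rw [e₃, norm_sub_sq_real, norm_smul, inner_smul_left, mul_pow, norm_sq_weakGrad (θ τ),
    inner_weakGrad, ← Finset.mul_sum]
  simp only [mul_assoc (rho z ^ α), ← Finset.mul_sum]
  simp [← sq]
  ring

theorem hasBallIntegral_e₄ (hS : SimilaritySolution p s₀ J θ θ₀₀ w w' w'') {α s τ : ℝ}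
    (hα : 2 < α) (hs : s ∈ J) (hτ : τ ∈ J) : HasBallIntegral (e₄ p α θ s τ)
      (g₂ p τ * divForm (α - 1) (θ τ) -
      2 * (g₂ p τ * inner ℝ (divMul N (α - 1) (cls (ballMeasure N) (θ τ)))
        (cls (ballMeasure N) (θ s)))) := by
  have h0 : (1 : ℝ) ≤ α - 1 := by linarith
  refine (((hasBallIntegral_div h0 (hS.memLp_theta hτ) (hS.memLp_theta hτ)).const_mul
    (g₂ p τ)).sub (((hasBallIntegral_div h0 (hS.memLp_theta hτ)
      (hS.memLp_theta hs)).const_mul (g₂ p τ)).const_mul 2)).congr (fun z _ => ?_) rfl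
  rw [e₄, sq_abs, sq_abs, show α - 1 - 1 = α - 2 by ring]
  ring

theorem g_mul_exp (p τ : ℝ) : g p τ * Real.exp (-2 * τ) = g₂ p τ := by
  rw [g, g₂, ← Real.exp_add]; congr 1; ring

/-- The factor `e^{-2τ}` turns `g` into `g₂` in the cross term, which is the factor in `∂_s w = g₂
θ`. -/
theorem hasBallIntegral_e₅ (hS : SimilaritySolution p s₀ J θ θ₀₀ w w' w'') {α s τ : ℝ}
    (hα : 2 < α) (hs : s ∈ J) (hτ : τ ∈ J) : HasBallIntegral (e₅ p α θ s τ)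
      (g p τ * massForm (α - 1) (θ τ) -
      2 * (∑ i, g₂ p τ * inner ℝ (coordMul (α - 1) i (cls (ballMeasure N) (θ τ)))
        (cls (ballMeasure N) (weakPartial i (θ s))))) := by
  have h0 : (0 : ℝ) ≤ α - 1 := by linarith
  refine (((hasBallIntegral_rho h0 (hS.memLp_theta hτ) (hS.memLp_theta hτ)).const_mul
    (g p τ)).sub ((HasBallIntegral.sum fun i => (hasBallIntegral_coord h0 i (hS.memLp_theta hτ)
      (hS.memLp_partial hs i)).const_mul (g₂ p τ)).const_mul 2)).congr (fun z _ => ?_) rfl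
  have h1 : ∑ i, g₂ p τ * (z i * rho z ^ (α - 1) * θ τ z * weakPartial i (θ s) z) =
      g₂ p τ * rho z ^ (α - 1) * θ τ z * radial (θ s) z := by
    rw [radial_eq_sum, Finset.mul_sum]
    exact Finset.sum_congr rfl fun i _ => by ring
  rw [e₅, sq_abs, sq_abs, h1, ← g_mul_exp]
  ring

theorem initial_ae (hS : SimilaritySolution p s₀ J θ θ₀₀ w w' w'') :
    (fun z => (g p s₀)⁻¹ * w s₀ z) =ᵐ[volume] θ₀₀ := by
  filter_upwards [hS.initial] with z hz
  have := (g_pos p s₀).ne'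
  rw [hz]; field_simp

theorem hasWeakPartial_initial (hS : SimilaritySolution p s₀ J θ θ₀₀ w w' w'') (h₀ : s₀ ∈ J)
    (i : Fin N) : HasWeakPartial i θ₀₀ fun z => (g p s₀)⁻¹ * w' i s₀ z :=
  ((hS.hasWeakPartial_w s₀ h₀ i).const_mul _).congr hS.initial_ae (ae_eq_refl _)

theorem memLp_partial_initial (hS : SimilaritySolution p s₀ J θ θ₀₀ w w' w'') (h₀ : s₀ ∈ J)
    (i : Fin N) : MemLp (weakPartial i θ₀₀) 2 (ballMeasure N) :=
  (((hS.memL2Loc_w' s₀ h₀ i).const_mul _).congr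
    (hS.hasWeakPartial_initial h₀ i).weakPartial_ae_eq.symm).memLp_ball

/-- Identifies the initial gradient terms with the lower end point values of the time integrals, so
that they cancel. -/
theorem cls_partial_initial (hS : SimilaritySolution p s₀ J θ θ₀₀ w w' w'') (h₀ : s₀ ∈ J)
    (i : Fin N) : g p s₀ • cls (ballMeasure N) (weakPartial i θ₀₀) =
      cls (ballMeasure N) (w' i s₀) := by
  rw [cls_congr (ae_restrict_of_ae (hS.hasWeakPartial_initial h₀ i).weakPartial_ae_eq),
    cls_smul _ (hS.memL2Loc_w' s₀ h₀ i).memLp_ball, smul_smul, mul_inv_cancel₀ (g_pos p s₀).ne',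
    one_smul]

theorem memLp_radial {f : X N → ℝ} (hf : ∀ i, MemLp (weakPartial i f) 2 (ballMeasure N)) :
    MemLp (radial f) 2 (ballMeasure N) := by
  rw [show radial f = fun z => ∑ i, z i * weakPartial i f z from funext (radial_eq_sum f)]
  exact memLp_finsetSum _ fun i _ => (hf i).mul (memLp_top_of_continuous (by fun_prop))

theorem hasBallIntegral_e₆ (hS : SimilaritySolution p s₀ J θ θ₀₀ w w' w'') {α s : ℝ}
    (h₀ : s₀ ∈ J) (hα : 2 < α) (hs : s ∈ J) : HasBallIntegral (e₆ α θ θ₀₀ s)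
      (2 * (∑ i, inner ℝ (rhoMul N α (cls (ballMeasure N) (weakPartial i θ₀₀)))
        (cls (ballMeasure N) (weakPartial i (θ s)))) +
      dirichletForm α θ₀₀) := by
  have h1 : (0 : ℝ) ≤ α := by linarith
  have hZ := hS.memLp_partial_initial h₀
  refine (((HasBallIntegral.sum fun i => hasBallIntegral_rho h1 (hZ i)
    (hS.memLp_partial hs i)).const_mul 2).add
    (HasBallIntegral.sum fun i => hasBallIntegral_rho h1 (hZ i) (hZ i))).congr (fun z _ => ?_) rfl
  rw [e₆, norm_add_sq_real, real_inner_comm, norm_sq_weakGrad θ₀₀, inner_weakGrad]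
  simp only [mul_assoc (rho z ^ α), ← Finset.mul_sum, ← sq]
  ring

theorem hasBallIntegral_e₇ (hS : SimilaritySolution p s₀ J θ θ₀₀ w w' w'') {α s : ℝ}
    (h₀ : s₀ ∈ J) (hα : 2 < α) (hs : s ∈ J) : HasBallIntegral (e₇ α θ θ₀₀ s)
      (massForm (α - 1) (radial θ₀₀) -
      2 * (∑ i, inner ℝ (coordMul (α - 1) i (cls (ballMeasure N) (weakPartial i θ₀₀)))
        (cls (ballMeasure N) (θ s)))) := by
  have h1 : (0 : ℝ) ≤ α - 1 := by linarith
  have hZ := hS.memLp_partial_initial h₀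
  refine ((hasBallIntegral_rho h1 (memLp_radial hZ) (memLp_radial hZ)).sub
    ((HasBallIntegral.sum fun i => hasBallIntegral_coord h1 i (hZ i)
      (hS.memLp_theta hs)).const_mul 2)).congr (fun z _ => ?_) rfl
  have h2 : ∑ i, z i * rho z ^ (α - 1) * weakPartial i θ₀₀ z * θ s z =
      rho z ^ (α - 1) * θ s z * radial θ₀₀ z := by
    rw [radial_eq_sum, Finset.mul_sum]
    exact Finset.sum_congr rfl fun i _ => by ring
  rw [e₇, sq_abs, sq_abs, h2]
  ring

/-! The integrals of the dissipation. -/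

theorem hasBallIntegral_d₂ (hS : SimilaritySolution p s₀ J θ θ₀₀ w w' w'') {α s : ℝ}
    (hα : 2 < α) (hs : s ∈ J) : HasBallIntegral (d₂ p α (timeDeriv J θ) s) (g p s *
      massForm α (timeDeriv J θ s)) :=
  ((hasBallIntegral_rho (by linarith) (hS.memL2Loc_timeDeriv hs).memLp_ball
    (hS.memL2Loc_timeDeriv hs).memLp_ball).const_mul (g p s)).congr
      (fun z _ => by simp only [d₂]; ring) rfl

/-- On the ball `|z|² ρ^{α-1} = ρ^{α-1} - ρ^α`. -/
theorem hasBallIntegral_d₄ (hS : SimilaritySolution p s₀ J θ θ₀₀ w w' w'') {α s : ℝ}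
    (hα : 2 < α) (hs : s ∈ J) : HasBallIntegral (d₄ p α θ s) (g p s *
      massForm (α - 1) (θ s) -
      g p s * massForm α (θ s)) := by
  have m := hS.memLp_theta hs
  refine (((hasBallIntegral_rho (by linarith) m m).const_mul (g p s)).sub
    ((hasBallIntegral_rho (by linarith) m m).const_mul (g p s))).congr (fun z hz => ?_) rfl
  have h1 : rho z ^ α = rho z * rho z ^ (α - 1) := by
    rcases (rho_nonneg hz).eq_or_lt with h0 | h0
    · rw [← h0, Real.zero_rpow (by linarith), zero_mul]
    · rw [Real.rpow_sub_one h0.ne']; field_simp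
  have h2 : ‖z‖ ^ 2 = 1 - rho z := by simp [rho]
  rw [d₄, sq_abs, h1, h2]
  ring

theorem hasBallIntegral_d₅ (hS : SimilaritySolution p s₀ J θ θ₀₀ w w' w'') {α s : ℝ}
    (hα : 2 < α) (hs : s ∈ J) : HasBallIntegral (d₅ p α θ s) (g₂ p s *
      dirichletForm α (θ s)) := by
  refine ((HasBallIntegral.sum fun i => hasBallIntegral_rho (by linarith) (hS.memLp_partial hs i)
    (hS.memLp_partial hs i)).const_mul (g₂ p s)).congr (fun z _ => ?_) rfl
  rw [d₅, norm_sq_weakGrad]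
  simp only [mul_assoc (rho z ^ α), ← Finset.mul_sum, ← sq]
  ring

end SimilaritySolution

end WaveEnergy

/-! ### Evaluation of the time integrals and reduction of the energy to `core` -/

namespace WaveEnergy

theorem iteratedIntegrable_of_continuousOn {N : ℕ} {f : ℝ → X N → ℝ} {c : ℝ → ℝ} {a b : ℝ}
    (hab : a ≤ b) (hf : ∀ τ ∈ Icc a b, HasBallIntegral (f τ) (c τ))
    (hc : ContinuousOn c (Icc a b)) :
    IteratedIntegrable f a b ∧ ∫ τ in a..b, ∫ z in B N, f τ z = ∫ τ in a..b, c τ := by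
  have h1 : ContinuousOn (fun τ => ∫ z in B N, f τ z) (Icc a b) := hc.congr fun τ hτ => (hf τ hτ).2
  refine ⟨⟨fun τ hτ => (hf τ hτ).1, h1.intervalIntegrable_of_Icc hab⟩, ?_⟩
  refine intervalIntegral.integral_congr fun τ hτ => ?_
  rw [uIcc_of_le hab] at hτ
  exact (hf τ hτ).2

/-- The fundamental theorem of calculus in the inner time variable `τ`, with the second argument `h`
(a quantity at the outer time) fixed. -/
theorem integral_inner_of_hasDerivWithinAt {H : Type*} [NormedAddCommGroup H]
    [InnerProductSpace ℝ H] {Y Z : ℝ → H} {γ : ℝ → ℝ} {a b s : ℝ} (hs : s ∈ Icc a b)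
    (hY : ∀ τ ∈ Icc a b, HasDerivWithinAt Y (γ τ • Z τ) (Icc a b) τ) (hγ : Continuous γ)
    (hZ : ContinuousOn Z (Icc a b)) (A : H →L[ℝ] H) (h : H) :
    ∫ τ in a..s, γ τ * inner ℝ (A (Z τ)) h = inner ℝ (A (Y s)) h - inner ℝ (A (Y a)) h := by
  have hd : ∀ τ ∈ Icc a b, HasDerivWithinAt (fun τ => inner ℝ (A (Y τ)) h)
      (γ τ * inner ℝ (A (Z τ)) h) (Icc a b) τ := fun τ hτ => by
    have h1 : HasDerivWithinAt (fun τ => A (Y τ)) (A (γ τ • Z τ)) (Icc a b) τ :=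
      A.hasFDerivAt.comp_hasDerivWithinAt τ (hY τ hτ)
    refine (h1.inner ℝ (hasDerivWithinAt_const τ (Icc a b) h)).congr_deriv ?_
    simp [inner_smul_left]
  have hsub : Icc a s ⊆ Icc a b := Icc_subset_Icc_right hs.2
  refine intervalIntegral.integral_eq_sub_of_hasDerivAt_of_le hs.1
    (fun τ hτ => (hd τ (hsub hτ)).continuousWithinAt.mono hsub) (fun τ hτ =>
      (hd τ (hsub (Ioo_subset_Icc_self hτ))).hasDerivAt
        (Icc_mem_nhds hτ.1 (hτ.2.trans_le hs.2))) ?_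
  refine ContinuousOn.intervalIntegrable_of_Icc hs.1 ?_
  exact hγ.continuousOn.mul ((A.continuous.comp_continuousOn (hZ.mono hsub)).inner
    continuousOn_const)

namespace SimilaritySolution

variable {N : ℕ} {p s₀ : ℝ} {J : Set ℝ} {θ : ℝ → X N → ℝ} {θ₀₀ : X N → ℝ}
  {w : ℝ → X N → ℝ} {w' w'' : Fin N → ℝ → X N → ℝ}

/-- The part of the energy without time integrals, after integration by parts. -/
noncomputable def core (p α : ℝ) (θ : ℝ → X N → ℝ) (w' : Fin N → ℝ → X N → ℝ) (s : ℝ) : ℝ :=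
  bet p / 2 * (g p s * massForm α (θ s)) - 1 / (p + 1) * (g p s * powerForm p α θ s)
  + (∑ i, inner ℝ (rhoMul N α (cls (ballMeasure N) (w' i s)))
      (cls (ballMeasure N) (weakPartial i (θ s)))
    - 2 * α * ∑ i, inner ℝ (coordMul (α - 1) i (cls (ballMeasure N) (w' i s)))
      (cls (ballMeasure N) (θ s)))

theorem continuousOn_inner {H : Type*} [NormedAddCommGroup H] [InnerProductSpace ℝ H]
    {f h : ℝ → H} {I : Set ℝ} (A : H →L[ℝ] H) (hf : ContinuousOn f I) (hh : ContinuousOn h I) :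
    ContinuousOn (fun s => inner ℝ (A (f s)) (h s)) I :=
  (A.continuous.comp_continuousOn hf).inner hh

theorem continuousOn_massForm (hS : SimilaritySolution p s₀ J θ θ₀₀ w w' w'') (γ : ℝ) :
    ContinuousOn (fun s => massForm γ (θ s)) J :=
  continuousOn_inner _ hS.continuousOn_theta hS.continuousOn_theta

theorem continuousOn_massForm_timeDeriv (hS : SimilaritySolution p s₀ J θ θ₀₀ w w' w'') (γ : ℝ) :
    ContinuousOn (fun s => massForm γ (timeDeriv J θ s)) J :=
  continuousOn_inner _ hS.continuousOn_timeDeriv hS.continuousOn_timeDeriv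

theorem continuousOn_powerForm (hS : SimilaritySolution p s₀ J θ θ₀₀ w w' w'') (α : ℝ) :
    ContinuousOn (powerForm p α θ) J :=
  continuousOn_inner _ hS.continuousOn_nonlin hS.continuousOn_theta

theorem continuousOn_dirichletForm (hS : SimilaritySolution p s₀ J θ θ₀₀ w w' w'') (α : ℝ) :
    ContinuousOn (fun s => dirichletForm α (θ s)) J :=
  continuousOn_finsetSum _ fun i _ =>
    continuousOn_inner _ (hS.continuousOn_partial i) (hS.continuousOn_partial i)

theorem continuousOn_divForm (hS : SimilaritySolution p s₀ J θ θ₀₀ w w' w'') (γ : ℝ) :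
    ContinuousOn (fun s => divForm γ (θ s)) J :=
  continuousOn_inner _ hS.continuousOn_theta hS.continuousOn_theta

/-- Merges the cross terms of `e₄` and `e₅` into a single pairing of `z·∇w` with `θ`. -/
theorem inner_div_add_coord (hS : SimilaritySolution p s₀ J θ θ₀₀ w w' w'') {γ r s : ℝ}
    (hγ : 1 < γ) (hr : r ∈ J) (hs : s ∈ J) :
    inner ℝ (divMul N γ (cls (ballMeasure N) (w r))) (cls (ballMeasure N) (θ s)) +
      ∑ i, inner ℝ (coordMul γ i (cls (ballMeasure N) (w r)))
        (cls (ballMeasure N) (weakPartial i (θ s))) =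
    -∑ i, inner ℝ (coordMul γ i (cls (ballMeasure N) (w' i r))) (cls (ballMeasure N) (θ s)) := by
  rw [inner_divMul hγ (hS.hasWeakPartial_w r hr) (hS.hasWeakPartial s hs) (hS.memL2Loc_w r hr)
    (hS.memL2Loc_w' r hr) (hS.memL2Loc s hs) (hS.memL2Loc_partial s hs), Finset.sum_add_distrib]
  ring

/-- All integrals in the energy converge, and the energy in terms of `core`. -/
theorem energy_eq (hp : 1 < p) (hS : SimilaritySolution p s₀ J θ θ₀₀ w w' w'') {α : ℝ}
    (hα : 2 < α) : ∃ K : ℝ, ∀ s ∈ J, EnergyConverges p α s₀ θ θ₀₀ s ∧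
      energy p α s₀ θ θ₀₀ s = core p α θ w' s
        - 2 * (∫ τ in s₀..s, g₂ p τ * dirichletForm α (θ τ))
        - α * (∫ τ in s₀..s, g₂ p τ * divForm (α - 1) (θ τ))
        - α * (∫ τ in s₀..s, g p τ * massForm (α - 1) (θ τ)) + K := by
  -- The constant collects the parts of `e₆` and `e₇` that are quadratic in the initial data.
  refine ⟨1 / 2 * g p s₀ * dirichletForm α θ₀₀ +
    α * g p s₀ * massForm (α - 1) (radial θ₀₀), fun s hs => ?_⟩
  have h₀s := hS.le_of_mem s hs
  have hsub := hS.Icc_subset s hs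
  have h₀ : s₀ ∈ J := hsub (left_mem_Icc.2 h₀s)
  -- A later time `b` gives a nondegenerate interval to differentiate on, also when `s = s₀`.
  obtain ⟨b, hb, hsb⟩ := hS.exists_gt s hs
  have hbsub := hS.Icc_subset b hb
  have h₀b : s₀ < b := h₀s.trans_lt hsb
  have hsI : s ∈ Icc s₀ b := ⟨h₀s, hsb.le⟩
  have cg₂ : ContinuousOn (g₂ p) (Icc s₀ s) := (continuous_g₂ p).continuousOn
  have cg : ContinuousOn (g p) (Icc s₀ s) := (continuous_g p).continuousOn
  have cθ := hS.continuousOn_theta.mono hsub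
  have cΨ := fun i => (hS.continuousOn_partial i).mono hsub
  have t3 : ContinuousOn (fun τ => g₂ p τ * dirichletForm α (θ τ)) (Icc s₀ s) :=
    cg₂.mul ((hS.continuousOn_dirichletForm α).mono hsub)
  have t3' : ∀ i, ContinuousOn (fun τ => g₂ p τ *
      inner ℝ (rhoMul N α (cls (ballMeasure N) (weakPartial i (θ τ))))
        (cls (ballMeasure N) (weakPartial i (θ s)))) (Icc s₀ s) := fun i =>
    cg₂.mul (continuousOn_inner _ (cΨ i) continuousOn_const)
  have t4 : ContinuousOn (fun τ => g₂ p τ * divForm (α - 1) (θ τ)) (Icc s₀ s) :=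
    cg₂.mul ((hS.continuousOn_divForm (α - 1)).mono hsub)
  have t4' : ContinuousOn (fun τ => g₂ p τ *
      inner ℝ (divMul N (α - 1) (cls (ballMeasure N) (θ τ)))
        (cls (ballMeasure N) (θ s))) (Icc s₀ s) :=
    cg₂.mul (continuousOn_inner _ cθ continuousOn_const)
  have t5 : ContinuousOn (fun τ => g p τ * massForm (α - 1) (θ τ)) (Icc s₀ s) :=
    cg.mul ((hS.continuousOn_massForm (α - 1)).mono hsub)
  have t5' : ∀ i, ContinuousOn (fun τ => g₂ p τ *
      inner ℝ (coordMul (α - 1) i (cls (ballMeasure N) (θ τ)))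
        (cls (ballMeasure N) (weakPartial i (θ s)))) (Icc s₀ s) := fun i =>
    cg₂.mul (continuousOn_inner _ cθ continuousOn_const)
  obtain ⟨i3, v3⟩ := iteratedIntegrable_of_continuousOn h₀s
    (fun τ hτ => hS.hasBallIntegral_e₃ hα hs (hsub hτ))
    ((continuousOn_const.mul t3).sub
      (continuousOn_const.mul (continuousOn_finsetSum _ fun i _ => t3' i)))
  obtain ⟨i4, v4⟩ := iteratedIntegrable_of_continuousOn h₀s
    (fun τ hτ => hS.hasBallIntegral_e₄ hα hs (hsub hτ)) (t4.sub (continuousOn_const.mul t4'))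
  obtain ⟨i5, v5⟩ := iteratedIntegrable_of_continuousOn h₀s
    (fun τ hτ => hS.hasBallIntegral_e₅ hα hs (hsub hτ))
    (t5.sub (continuousOn_const.mul (continuousOn_finsetSum _ fun i _ => t5' i)))
  have b1 := hS.hasBallIntegral_e₁ hα hs
  have b2 := hS.hasBallIntegral_e₂ hp hα hs
  have b6 := hS.hasBallIntegral_e₆ h₀ hα hs
  have b7 := hS.hasBallIntegral_e₇ h₀ hα hs
  refine ⟨⟨b1.1, b2.1, i3, i4, i5, b6.1, b7.1⟩, ?_⟩
  have n3 := t3.intervalIntegrable_of_Icc (μ := volume) h₀s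
  have n3' := fun i => (t3' i).intervalIntegrable_of_Icc (μ := volume) h₀s
  have n4 := t4.intervalIntegrable_of_Icc (μ := volume) h₀s
  have n4' := t4'.intervalIntegrable_of_Icc (μ := volume) h₀s
  have n5 := t5.intervalIntegrable_of_Icc (μ := volume) h₀s
  have n5' := fun i => (t5' i).intervalIntegrable_of_Icc (μ := volume) h₀s
  have m3 : IntervalIntegrable (fun τ => ∑ i, g₂ p τ *
      inner ℝ (rhoMul N α (cls (ballMeasure N) (weakPartial i (θ τ))))
        (cls (ballMeasure N) (weakPartial i (θ s)))) volume s₀ s :=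
    (continuousOn_finsetSum _ fun i _ => t3' i).intervalIntegrable_of_Icc h₀s
  have m5 : IntervalIntegrable (fun τ => ∑ i, g₂ p τ *
      inner ℝ (coordMul (α - 1) i (cls (ballMeasure N) (θ τ)))
        (cls (ballMeasure N) (weakPartial i (θ s)))) volume s₀ s :=
    (continuousOn_finsetSum _ fun i _ => t5' i).intervalIntegrable_of_Icc h₀s
  have f3 := fun i => integral_inner_of_hasDerivWithinAt hsI
    (fun τ hτ => hS.hasDerivWithinAt_w' i hb h₀b hτ) (continuous_g₂ p)
    ((hS.continuousOn_partial i).mono hbsub) (rhoMul N α)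
    (cls (ballMeasure N) (weakPartial i (θ s)))
  have f4 := integral_inner_of_hasDerivWithinAt hsI
    (fun τ hτ => (hS.hasDerivWithinAt_w τ (hbsub hτ)).mono hbsub) (continuous_g₂ p)
    (hS.continuousOn_theta.mono hbsub) (divMul N (α - 1)) (cls (ballMeasure N) (θ s))
  have f5 := fun i => integral_inner_of_hasDerivWithinAt hsI
    (fun τ hτ => (hS.hasDerivWithinAt_w τ (hbsub hτ)).mono hbsub) (continuous_g₂ p)
    (hS.continuousOn_theta.mono hbsub) (coordMul (α - 1) i)
    (cls (ballMeasure N) (weakPartial i (θ s)))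
  rw [intervalIntegral.integral_sub (n3.const_mul 16) (m3.const_mul 8),
    intervalIntegral.integral_const_mul, intervalIntegral.integral_const_mul,
    intervalIntegral.integral_finsetSum fun i _ => n3' i, Finset.sum_congr rfl fun i _ => f3 i,
    Finset.sum_sub_distrib] at v3
  rw [intervalIntegral.integral_sub n4 (n4'.const_mul 2),
    intervalIntegral.integral_const_mul, f4] at v4
  rw [intervalIntegral.integral_sub n5 (m5.const_mul 2),
    intervalIntegral.integral_const_mul,
    intervalIntegral.integral_finsetSum fun i _ => n5' i, Finset.sum_congr rfl fun i _ => f5 i,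
    Finset.sum_sub_distrib] at v5
  have z6 : ∑ i, inner ℝ (rhoMul N α (cls (ballMeasure N) (w' i s₀)))
      (cls (ballMeasure N) (weakPartial i (θ s))) =
      g p s₀ * ∑ i, inner ℝ (rhoMul N α (cls (ballMeasure N) (weakPartial i θ₀₀)))
      (cls (ballMeasure N) (weakPartial i (θ s))) := by
    simp [← hS.cls_partial_initial h₀, inner_smul_left, Finset.mul_sum]
  have z7 : ∑ i, inner ℝ (coordMul (α - 1) i (cls (ballMeasure N) (w' i s₀)))
      (cls (ballMeasure N) (θ s)) =
      g p s₀ * ∑ i, inner ℝ (coordMul (α - 1) i (cls (ballMeasure N) (weakPartial i θ₀₀)))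
      (cls (ballMeasure N) (θ s)) := by
    simp [← hS.cls_partial_initial h₀, inner_smul_left, Finset.mul_sum]
  have y1 := hS.inner_div_add_coord (by linarith : 1 < α - 1) hs hs
  have y2 := hS.inner_div_add_coord (by linarith : 1 < α - 1) h₀ hs
  rw [energy, v3, v4, v5, b1.2, b2.2, b6.2, b7.2, core]
  rw [z6]
  rw [z7] at y2
  -- The upper end points give the `z·∇w` term of `core` through `y1`; through `y2` the lower ones
  -- cancel the linear part of `e₇`, while those of `e₃` and `e₆` cancel by `z6`.
  linear_combination 2 * α * y1 - 2 * α * y2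

end SimilaritySolution

end WaveEnergy

namespace WaveEnergy

/-! ### The derivative of `core` and the dissipation identity -/

namespace SimilaritySolution

variable {N : ℕ} {p s₀ : ℝ} {J : Set ℝ} {θ : ℝ → X N → ℝ} {θ₀₀ : X N → ℝ}
  {w : ℝ → X N → ℝ} {w' w'' : Fin N → ℝ → X N → ℝ}

theorem hasDerivWithinAt_core (hp : 1 < p) (hS : SimilaritySolution p s₀ J θ θ₀₀ w w' w'')
    {α b s : ℝ} (hα : 2 < α) (hb : b ∈ J) (hb' : s₀ < b) (hs : s ∈ Icc s₀ b) :
    HasDerivWithinAt (core p α θ w')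
      (-((bet p + 1) / (p + 1)) * (g p s * powerForm p α θ s)
        - g p s * massForm α (timeDeriv J θ s)
        + bet p * (bet p + 1) / 2 * (g p s * massForm α (θ s))
        + g₂ p s * dirichletForm α (θ s)
        + α * (g₂ p s * divForm (α - 1) (θ s))) (Icc s₀ b) s := by
  have hsub := hS.Icc_subset b hb
  have hsJ := hsub hs
  have h0 : (0 : ℝ) ≤ α := by linarith
  have hgs : g p s ≠ 0 := (g_pos p s).ne'
  refine hasDerivWithinAt_energy_core hs (R := rhoMul N α) (V := divMul N (α - 1))
    (C := coordMul (α - 1)) (Θ := fun s => cls (ballMeasure N) (θ s))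
    (L := fun s => ∑ i, cls (ballMeasure N) (w'' i s))
    (F := fun s => cls (ballMeasure N) (nonlin p θ s))
    (W' := fun i s => cls (ballMeasure N) (w' i s))
    (Ψ := fun i s => cls (ballMeasure N) (weakPartial i (θ s)))
    (P := powerForm p α θ) (γ := g p)
    (inner_mulC_comm (memLp_rho h0)) (by linarith)
    ((hS.hasDerivWithinAt_theta hsJ).mono hsub)
    (fun i => (hS.continuousOn_partial i s hsJ).mono hsub)
    (fun i => hS.hasDerivWithinAt_w' i hb hb' hs)
    ((hS.continuousOn_nonlin s hsJ).mono hsub)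
    (fun r hr r' hr' => hS.nonlin_subgradient hp h0 (hsub hr) (hsub hr'))
    (hasDerivAt_g p s).hasDerivWithinAt ?_ ?_ ?_
  · rw [hS.cls_nonlin hsJ, smul_sub, smul_inv_smul₀ hgs]
  · intro r hr
    have h1 := fun i => inner_rhoMul_partial (by linarith : 1 < α) (hS.hasWeakPartial_w' s hsJ i)
      (hS.hasWeakPartial r (hsub hr) i) (hS.memL2Loc_w' s hsJ i) (hS.memL2Loc_w'' s hsJ i)
      (hS.memL2Loc r (hsub hr)) (hS.memL2Loc_partial r (hsub hr) i)
    have h2 := Finset.sum_congr (rfl : (Finset.univ : Finset (Fin N)) = Finset.univ)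
      fun i _ => h1 i
    rw [← Finset.mul_sum, Finset.sum_add_distrib] at h2
    rw [map_sum, sum_inner]
    linarith
  · have h1 := inner_divMul (by linarith : 1 < α - 1) (hS.hasWeakPartial s hsJ)
      (hS.hasWeakPartial s hsJ) (hS.memL2Loc s hsJ) (hS.memL2Loc_partial s hsJ)
      (hS.memL2Loc s hsJ) (hS.memL2Loc_partial s hsJ)
    rw [h1, Finset.mul_sum]
    congr 1
    refine Finset.sum_congr rfl fun i _ => ?_
    rw [coordMul, inner_mulC_comm (memLp_coord (by linarith) i)
      (cls (ballMeasure N) (θ s)) (cls (ballMeasure N) (weakPartial i (θ s)))]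
    ring

theorem iteratedIntegrable_dissipation (hp : 1 < p)
    (hS : SimilaritySolution p s₀ J θ θ₀₀ w w' w'') {α s₁ s₂ : ℝ} (hα : 2 < α) (h₁ : s₀ ≤ s₁)
    (h₁₂ : s₁ ≤ s₂) (h₂ : s₂ ∈ J) :
    (IteratedIntegrable (d₁ p α θ) s₁ s₂ ∧ ∫ s in s₁..s₂, ∫ z in B N, d₁ p α θ s z =
      ∫ s in s₁..s₂, g p s * powerForm p α θ s) ∧
    (IteratedIntegrable (d₂ p α (timeDeriv J θ)) s₁ s₂ ∧
      ∫ s in s₁..s₂, ∫ z in B N, d₂ p α (timeDeriv J θ) s z =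
      ∫ s in s₁..s₂, g p s * massForm α (timeDeriv J θ s)) ∧
    (IteratedIntegrable (d₃ p α θ) s₁ s₂ ∧ ∫ s in s₁..s₂, ∫ z in B N, d₃ p α θ s z =
      ∫ s in s₁..s₂, g p s * massForm α (θ s)) ∧
    (IteratedIntegrable (d₄ p α θ) s₁ s₂ ∧ ∫ s in s₁..s₂, ∫ z in B N, d₄ p α θ s z =
      ∫ s in s₁..s₂, (g p s * massForm (α - 1) (θ s) - g p s * massForm α (θ s))) ∧
    (IteratedIntegrable (d₅ p α θ) s₁ s₂ ∧ ∫ s in s₁..s₂, ∫ z in B N, d₅ p α θ s z =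
      ∫ s in s₁..s₂, g₂ p s * dirichletForm α (θ s)) := by
  have hsub : Icc s₁ s₂ ⊆ J := (Icc_subset_Icc_left h₁).trans (hS.Icc_subset s₂ h₂)
  have cg : ContinuousOn (g p) (Icc s₁ s₂) := (continuous_g p).continuousOn
  have cg₂ : ContinuousOn (g₂ p) (Icc s₁ s₂) := (continuous_g₂ p).continuousOn
  have cm := fun γ => cg.mul ((hS.continuousOn_massForm γ).mono hsub)
  -- The integrands `d₁` and `d₃` are definitionally `e₂` and `e₁`.
  exact ⟨iteratedIntegrable_of_continuousOn h₁₂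
      (fun s hs => hS.hasBallIntegral_e₂ hp hα (hsub hs))
      (cg.mul ((hS.continuousOn_powerForm α).mono hsub)),
    iteratedIntegrable_of_continuousOn h₁₂ (fun s hs => hS.hasBallIntegral_d₂ hα (hsub hs))
      (cg.mul ((hS.continuousOn_massForm_timeDeriv α).mono hsub)),
    iteratedIntegrable_of_continuousOn h₁₂ (fun s hs => hS.hasBallIntegral_e₁ hα (hsub hs)) (cm α),
    iteratedIntegrable_of_continuousOn h₁₂ (fun s hs => hS.hasBallIntegral_d₄ hα (hsub hs))
      ((cm (α - 1)).sub (cm α)),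
    iteratedIntegrable_of_continuousOn h₁₂ (fun s hs => hS.hasBallIntegral_d₅ hα (hsub hs))
      (cg₂.mul ((hS.continuousOn_dirichletForm α).mono hsub))⟩

/-- Integrates the derivative of `core` and adds the increments of the remaining time integrals. The
divergence forms cancel and the Dirichlet form enters with coefficient `1 - 2 = -1`. -/
theorem energy_sub_energy (hp : 1 < p) (hS : SimilaritySolution p s₀ J θ θ₀₀ w w' w'')
    {α s₁ s₂ : ℝ} (hα : 2 < α) (h₁ : s₀ ≤ s₁) (h₁₂ : s₁ ≤ s₂) (h₂ : s₂ ∈ J) :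
    energy p α s₀ θ θ₀₀ s₂ - energy p α s₀ θ θ₀₀ s₁ =
      -((bet p + 1) / (p + 1)) * (∫ s in s₁..s₂, ∫ z in B N, d₁ p α θ s z)
      - (∫ s in s₁..s₂, ∫ z in B N, d₂ p α (timeDeriv J θ) s z)
      - (α - bet p * (bet p + 1) / 2) * (∫ s in s₁..s₂, ∫ z in B N, d₃ p α θ s z)
      - α * (∫ s in s₁..s₂, ∫ z in B N, d₄ p α θ s z)
      - (∫ s in s₁..s₂, ∫ z in B N, d₅ p α θ s z) := by
  obtain ⟨K, hK⟩ := hS.energy_eq hp hα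
  obtain ⟨b, hb, hb'⟩ := hS.exists_gt s₂ h₂
  have hbsub := hS.Icc_subset b hb
  have h₁J : s₁ ∈ J := hS.Icc_subset s₂ h₂ ⟨h₁, h₁₂⟩
  have h₀b : s₀ < b := (h₁.trans h₁₂).trans_lt hb'
  have cg : ContinuousOn (g p) J := (continuous_g p).continuousOn
  have cg₂ : ContinuousOn (g₂ p) J := (continuous_g₂ p).continuousOn
  have hint : ∀ {c : ℝ → ℝ}, ContinuousOn c J → ∀ {a a' : ℝ}, s₀ ≤ a → a ≤ a' → a' ∈ J →
      IntervalIntegrable c volume a a' := fun hc a a' h h' h'' =>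
    (hc.mono ((Icc_subset_Icc_left h).trans (hS.Icc_subset a' h''))).intervalIntegrable_of_Icc h'
  have c1 := cg.fun_mul (hS.continuousOn_powerForm α)
  have c2 := cg.fun_mul (hS.continuousOn_massForm_timeDeriv α)
  have c3 := cg.fun_mul (hS.continuousOn_massForm α)
  have c4 := cg.fun_mul (hS.continuousOn_massForm (α - 1))
  have c5 := cg₂.fun_mul (hS.continuousOn_dirichletForm α)
  have c6 := cg₂.fun_mul (hS.continuousOn_divForm (α - 1))
  have n1 := hint c1 h₁ h₁₂ h₂
  have n2 := hint c2 h₁ h₁₂ h₂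
  have n3 := hint c3 h₁ h₁₂ h₂
  have n4 := hint c4 h₁ h₁₂ h₂
  have n5 := hint c5 h₁ h₁₂ h₂
  have n6 := hint c6 h₁ h₁₂ h₂
  have hsub : Icc s₁ s₂ ⊆ Icc s₀ b := Icc_subset_Icc h₁ hb'.le
  have hcore := intervalIntegral.integral_eq_sub_of_hasDerivAt_of_le h₁₂
    (fun s hs => (hS.hasDerivWithinAt_core hp hα hb h₀b (hsub hs)).continuousWithinAt.mono hsub)
    (fun s hs => (hS.hasDerivWithinAt_core hp hα hb h₀b
      (hsub (Ioo_subset_Icc_self hs))).hasDerivAt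
        (Icc_mem_nhds (h₁.trans_lt hs.1) (hs.2.trans hb')))
    (((((n1.const_mul _).sub n2).add (n3.const_mul _)).add n5).add (n6.const_mul _))
  rw [intervalIntegral.integral_add
      ((((n1.const_mul _).sub n2).add (n3.const_mul _)).add n5) (n6.const_mul _),
    intervalIntegral.integral_add (((n1.const_mul _).sub n2).add (n3.const_mul _)) n5,
    intervalIntegral.integral_add ((n1.const_mul _).sub n2) (n3.const_mul _),
    intervalIntegral.integral_sub (n1.const_mul _) n2, intervalIntegral.integral_const_mul,
    intervalIntegral.integral_const_mul, intervalIntegral.integral_const_mul] at hcore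
  obtain ⟨⟨-, v1⟩, ⟨-, v2⟩, ⟨-, v3⟩, ⟨-, v4⟩, ⟨-, v5⟩⟩ :=
    hS.iteratedIntegrable_dissipation hp hα h₁ h₁₂ h₂
  rw [intervalIntegral.integral_sub n4 n3] at v4
  have hadd : ∀ {c : ℝ → ℝ}, ContinuousOn c J →
      (∫ s in s₀..s₂, c s) - ∫ s in s₀..s₁, c s = ∫ s in s₁..s₂, c s := fun hc =>
    intervalIntegral.integral_interval_sub_left (hint hc le_rfl (h₁.trans h₁₂) h₂)
      (hint hc le_rfl h₁ h₁J)
  have a4 := hadd c4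
  have a5 := hadd c5
  have a6 := hadd c6
  rw [(hK s₂ h₂).2, (hK s₁ h₁J).2, v1, v2, v3, v4, v5]
  -- By `v4`, the mass with weight `ρ^{α-1}` splits into the `d₃` and `d₄` terms; this is where the
  -- coefficient `α - β(β+1)/2` comes from.
  linear_combination -hcore - 2 * a5 - α * a6 - α * a4

end SimilaritySolution

end WaveEnergy

/-! ### The main theorem -/

theorem proposition2p1 (N : ℕ) (hN : 1 ≤ N) (p : ℝ) (hp : 1 < p)
    (α : ℝ) (hα : max (max (bet p * (bet p + 1) / 2) (1 + 2 * bet p)) 2 < α)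
    (T : ℝ) (hT : 0 < T) (u₀ u₁ : X N → ℝ) (u : ℝ → X N → ℝ)
    (hu : IsStrongSolution p T u₀ u₁ u)
    (T' : ℝ) (hT' : 0 < T') (a : X N)
    (s₀ : ℝ) (hs₀ : s₀ = sZero T')
    (J : Set ℝ) (hJ : J = sDomain T T')
    (θ : ℝ → X N → ℝ) (hθ : θ = theta p T T' a u)
    (θ₀₀ : X N → ℝ) (hθ₀₀ : θ₀₀ = thetaInit p T' a u₀)
    (E : ℝ → ℝ) (hE : E = energy p α s₀ θ θ₀₀) :
    -- the weak derivatives and the integrals involved exist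
    (∀ i, ∃ w, HasWeakPartial i θ₀₀ w) ∧
    (∀ s ∈ J, (∀ i, ∃ w, HasWeakPartial i (θ s) w) ∧ (∃ w, HasTimeDeriv J θ w s) ∧
      EnergyConverges p α s₀ θ θ₀₀ s) ∧
    (∀ s, s₀ ≤ s → s + 1 ∈ J →
      IteratedIntegrable (d₁ p α θ) s (s + 1) ∧
      IteratedIntegrable (d₂ p α (timeDeriv J θ)) s (s + 1) ∧
      IteratedIntegrable (d₃ p α θ) s (s + 1) ∧
      IteratedIntegrable (d₄ p α θ) s (s + 1) ∧
      IteratedIntegrable (d₅ p α θ) s (s + 1)) ∧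
    -- the energy is nonincreasing
    AntitoneOn E J ∧
    -- the dissipation identity
    (∀ s, s₀ ≤ s → s + 1 ∈ J →
      E (s + 1) - E s =
        -((bet p + 1) / (p + 1)) * (∫ s' in s..(s + 1), ∫ z in B N, d₁ p α θ s' z)
        - (∫ s' in s..(s + 1), ∫ z in B N, d₂ p α (timeDeriv J θ) s' z)
        - (α - bet p * (bet p + 1) / 2) *
            (∫ s' in s..(s + 1), ∫ z in B N, d₃ p α θ s' z)
        - α * (∫ s' in s..(s + 1), ∫ z in B N, d₄ p α θ s' z)
        - (∫ s' in s..(s + 1), ∫ z in B N, d₅ p α θ s' z)) := by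
  subst hs₀ hJ hθ hθ₀₀ hE
  have hα2 : 2 < α := (le_max_right _ _).trans_lt hα
  have hαβ : bet p * (bet p + 1) / 2 < α :=
    ((le_max_left _ _).trans (le_max_left _ _)).trans_lt hα
  have hS := hu.similaritySolution hp hT' a
  have h₀ : sZero T' ∈ sDomain T T' :=
    ⟨le_rfl, by simpa [sZero, Real.exp_log hT'] using hT⟩
  have hE := fun s hs => ((hS.energy_eq hp hα2).choose_spec s hs).1
  have hβ : 0 < bet p := by rw [bet]; exact one_div_pos.2 (by linarith)
  refine ⟨fun i => ⟨_, hS.hasWeakPartial_initial h₀ i⟩, fun s hs =>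
    ⟨fun i => ⟨_, hS.hasWeakPartial s hs i⟩, hS.exists_timeDeriv s hs, hE s hs⟩,
    fun s hs hs' => ?_, fun s₁ h₁ s₂ h₂ h₁₂ => ?_, fun s hs hs' =>
    hS.energy_sub_energy hp hα2 hs (by linarith) hs'⟩
  · obtain ⟨⟨i1, -⟩, ⟨i2, -⟩, ⟨i3, -⟩, ⟨i4, -⟩, ⟨i5, -⟩⟩ :=
      hS.iteratedIntegrable_dissipation hp hα2 hs (by linarith) hs'
    exact ⟨i1, i2, i3, i4, i5⟩
  -- The identity holds between any two times of `J`. All dissipation integrands are nonnegative on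
  -- the ball, and `α > β(β+1)/2` makes the coefficient of the mass term nonpositive.
  · have key := hS.energy_sub_energy hp hα2 h₁.1 h₁₂ h₂
    have hnn : ∀ f : ℝ → X N → ℝ, (∀ s, ∀ z ∈ B N, 0 ≤ f s z) →
        0 ≤ ∫ s in s₁..s₂, ∫ z in B N, f s z := fun f hf =>
      intervalIntegral.integral_nonneg h₁₂ fun s _ =>
        setIntegral_nonneg measurableSet_closedBall (hf s)
    have hg : ∀ s, 0 ≤ g p s := fun s => (SimilaritySolution.g_pos p s).le
    have hg₂ : ∀ s, 0 ≤ g₂ p s := fun s => (SimilaritySolution.g₂_pos p s).le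
    have hρ : ∀ (γ : ℝ) (z : X N), z ∈ B N → 0 ≤ rho z ^ γ :=
      fun γ z hz => Real.rpow_nonneg (rho_nonneg hz) γ
    have q1 := hnn (d₁ p α (theta p T T' a u)) fun s z hz =>
      mul_nonneg (mul_nonneg (hg s) (hρ _ z hz)) (Real.rpow_nonneg (abs_nonneg _) _)
    have q2 := hnn (d₂ p α (timeDeriv (sDomain T T') (theta p T T' a u))) fun s z hz =>
      mul_nonneg (mul_nonneg (hg s) (hρ _ z hz)) (sq_nonneg _)
    have q3 := hnn (d₃ p α (theta p T T' a u)) fun s z hz =>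
      mul_nonneg (mul_nonneg (hg s) (hρ _ z hz)) (sq_nonneg _)
    have q4 := hnn (d₄ p α (theta p T T' a u)) fun s z hz =>
      mul_nonneg (mul_nonneg (mul_nonneg (hg s) (hρ _ z hz)) (sq_nonneg _)) (sq_nonneg _)
    have q5 := hnn (d₅ p α (theta p T T' a u)) fun s z hz =>
      mul_nonneg (mul_nonneg (hg₂ s) (hρ _ z hz)) (sq_nonneg _)
    have r1 := mul_nonneg (show 0 ≤ (bet p + 1) / (p + 1) by positivity) q1
    have r3 := mul_nonneg (sub_nonneg.2 hαβ.le) q3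
    have r4 := mul_nonneg (show 0 ≤ α by linarith) q4
    linarith
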